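/- **Setting.** Let $T>0$, $c\in\mathbb R$, let $a_0,a_1,a_2,a_3>0$, and let $g_0,g_1\in C^4([0,T])$ with $g_i(0)=g_i'(0)=0$ for $i=0,1$. Call $a:\mathbb R\to\mathbb R$ *admissible* if $a\in W^{3,\infty}_{loc}(\mathbb R)$ (continuous representative), $a(0)=0$, $a_0\le a'\le a_1$, $|a''|\le a_2$ and $|a'''|\le a_3$ almost everywhere. For admissible $a$ consider $$\partial_t p+\partial_x u=0,\qquad \partial_t u+\partial_x p+a(u)=0 \qquad\text{on }(0,1)\times(0,T),$$ $$u(0,t)=g_0(t),\quad u(1,t)=g_1(t),\quad p(x,0)=c,\quad u(x,0)=0,$$ and its classical solutions $(p,u)\in C^1([0,T];L^2(0,1)^2)\cap C([0,T];H^1(0,1)^2)$. Values $u(x,t)$, $p(x,t)$ are those of the representatives continuous in $x\in[0,1]$. Call $\underline u<\overline u$ *velocity bounds* if $\underline u\le u(x,t)\le\overline u$ on $[0,1]\times[0,T]$ for every admissible $a$ and every classical solution $(p,u)$ for $a$. Let $D(F)\subset H^2(\underline u,\overline u)$ be the set of restrictions to $(\underline u,\overline u)$ of admissible functions that lie in $H^2(\underline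 u,\overline u)$, and let $$F:D(F)\to L^2(0,T),\qquad F(a)=p(0,\cdot)-p(1,\cdot),$$ where $(p,u)$ is the classical solution for an admissible function with restriction $a$. **Theorem [Compactness].** Velocity bounds exist. For every choice of velocity bounds $\underline u<\overline u$: 1. $F$ is well defined on $D(F)$: for each $a\in D(F)$ there is exactly one element of $L^2(0,T)$ that is the pressure drop $p(0,\cdot)-p(1,\cdot)$ of a classical solution for some admissible function with restriction $a$. 2. If $a_n\in D(F)$ and $a_n\rightharpoonup a$ weakly in $H^2(\underline u,\overline u)$, then $a\in D(F)$ and $F(a_n)\to F(a)$ strongly in $L^2(0,T)$. 3. $F$ is compact: it is continuous on $D(F)$ with respect to the norms of $H^2(\underline u,\overline u)$ and $L^2(0,T)$, and for every subset $B\subset D(F)$ that is bounded in $H^2(\underline u,\overline u)$ the closure of $F(B)$ in $L^2(0,T)$ is compact. -/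

import Mathlib

open MeasureTheory Set Filter Topology
open scoped ContDiff

/-- `g` is a weak derivative of `f` on the open set `I ⊆ ℝ`: both are locally integrable on `I` and
`∫_I f φ' = - ∫_I g φ` for all test functions `φ ∈ C_c^∞(I)`. -/
structure HasWeakDeriv (I : Set ℝ) (f g : ℝ → ℝ) : Prop where
  locallyIntegrableOn : LocallyIntegrableOn f I volume
  locallyIntegrableOn_deriv : LocallyIntegrableOn g I volume
  integral_eq : ∀ φ : ℝ → ℝ, ContDiff ℝ ∞ φ → HasCompactSupport φ → tsupport φ ⊆ I →
    ∫ x in I, f x * deriv φ x = - ∫ x in I, g x * φ x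

theorem HasWeakDeriv.congr {I : Set ℝ} {f g f₁ g₁ : ℝ → ℝ}
    (h : HasWeakDeriv I f g)
    (hf : f =ᵐ[volume.restrict I] f₁) (hg : g =ᵐ[volume.restrict I] g₁) :
    HasWeakDeriv I f₁ g₁ := by
  have key : ∀ {v v₁ : ℝ → ℝ}, v =ᵐ[volume.restrict I] v₁ →
      LocallyIntegrableOn v I volume → LocallyIntegrableOn v₁ I volume := by
    intro v v₁ hv hl x hx
    obtain ⟨s, hs, hi⟩ := hl x hx
    refine ⟨s ∩ I, inter_mem hs self_mem_nhdsWithin, ?_⟩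
    refine (hi.mono_set inter_subset_left).congr ?_
    exact ae_restrict_of_ae_restrict_of_subset inter_subset_right hv
  refine ⟨key hf h.1, key hg h.2, fun φ h1 h2 h3 => ?_⟩
  have e1 : ∫ x in I, f₁ x * deriv φ x = ∫ x in I, f x * deriv φ x := by
    apply integral_congr_ae
    filter_upwards [hf] with x hx
    rw [hx]
  have e2 : ∫ x in I, g₁ x * φ x = ∫ x in I, g x * φ x := by
    apply integral_congr_ae
    filter_upwards [hg] with x hx
    rw [hx]
  rw [e1, e2, h.integral_eq φ h1 h2 h3]

/-- A locally integrable function times a continuous function with compact support in `I` is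
integrable on `I`. -/
theorem HasWeakDeriv.integrableOn_mul {I : Set ℝ} {f φ : ℝ → ℝ}
    (hf : LocallyIntegrableOn f I volume) (hφ : Continuous φ) (hc : HasCompactSupport φ)
    (hs : tsupport φ ⊆ I) : IntegrableOn (fun x => f x * φ x) I volume := by
  have h1 : IntegrableOn f (tsupport φ) volume := hf.integrableOn_compact_subset hs hc
  have h2 : IntegrableOn (fun x => f x * φ x) (tsupport φ) volume :=
    h1.mul_continuousOn hφ.continuousOn hc
  refine IntegrableOn.integrable_of_forall_notMem_eq_zero h2 ?_ |>.integrableOn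
  intro x hx
  rw [image_eq_zero_of_notMem_tsupport hx, mul_zero]

theorem HasWeakDeriv.add {I : Set ℝ} {f g f₁ g₁ : ℝ → ℝ}
    (h : HasWeakDeriv I f g) (h₁ : HasWeakDeriv I f₁ g₁) :
    HasWeakDeriv I (fun x => f x + f₁ x) (fun x => g x + g₁ x) := by
  refine ⟨h.1.add h₁.1, h.2.add h₁.2, fun φ k1 k2 k3 => ?_⟩
  have c : Continuous (deriv φ) := k1.continuous_deriv (by norm_num)
  have t : tsupport (deriv φ) ⊆ I := (tsupport_deriv_subset (𝕜 := ℝ) (f := φ)).trans k3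
  simp only [add_mul]
  rw [integral_add (HasWeakDeriv.integrableOn_mul h.1 c k2.deriv t)
      (HasWeakDeriv.integrableOn_mul h₁.1 c k2.deriv t),
    integral_add (HasWeakDeriv.integrableOn_mul h.2 k1.continuous k2 k3)
      (HasWeakDeriv.integrableOn_mul h₁.2 k1.continuous k2 k3),
    h.integral_eq φ k1 k2 k3, h₁.integral_eq φ k1 k2 k3]
  ring

theorem HasWeakDeriv.const_mul {I : Set ℝ} {f g : ℝ → ℝ} (r : ℝ) (h : HasWeakDeriv I f g) :
    HasWeakDeriv I (fun x => r * f x) (fun x => r * g x) := by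
  refine ⟨h.1.smul r, h.2.smul r, fun φ k1 k2 k3 => ?_⟩
  simp only [mul_assoc, integral_const_mul]
  rw [h.integral_eq φ k1 k2 k3]
  ring

/-- The real Hilbert space `L²(α, β)`. -/
abbrev L2Interval (α β : ℝ) : Type := Lp ℝ 2 (volume.restrict (Ioo α β))

/-- The Sobolev space `H^k(α, β)`: an element is the tuple `(f, f', …, f^(k))` of a function
`f ∈ L²(α, β)` and its weak derivatives, all of which lie in `L²(α, β)`. The tuple is determined by
`f`. The inherited norm is `‖f‖² = ∑_{j ≤ k} ‖f^(j)‖²_{L²}`. -/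
noncomputable def SobolevSpace (k : ℕ) (α β : ℝ) :
    Submodule ℝ (PiLp 2 (fun _ : Fin (k + 1) => L2Interval α β)) where
  carrier := {F | ∀ j : Fin k, HasWeakDeriv (Ioo α β) (F j.castSucc) (F j.succ)}
  zero_mem' := by
    intro j
    have h0 : HasWeakDeriv (Ioo α β) (fun _ => 0) (fun _ => 0) :=
      ⟨locallyIntegrable_zero.locallyIntegrableOn _, locallyIntegrable_zero.locallyIntegrableOn _,
        fun φ _ _ _ => by simp⟩
    exact h0.congr (Lp.coeFn_zero _ _ _).symm (Lp.coeFn_zero _ _ _).symm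
  add_mem' := by
    intro F G hF hG j
    exact ((hF j).add (hG j)).congr (Lp.coeFn_add _ _).symm
      (Lp.coeFn_add _ _).symm
  smul_mem' := by
    intro r F hF j
    exact ((hF j).const_mul r).congr (Lp.coeFn_smul r _).symm
      (Lp.coeFn_smul r _).symm

/-- The `j`-th weak derivative of `f ∈ H^k(α, β)` as an element of `L²(α, β)`; for `j = 0` this is
`f` itself. -/
noncomputable def weakDerivL2 {k : ℕ} {α β : ℝ} (j : Fin (k + 1))
    (f : SobolevSpace k α β) : L2Interval α β :=
  (f : PiLp 2 (fun _ : Fin (k + 1) => L2Interval α β)) j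

/-- Classical solution `(p, u) ∈ C¹([0,T]; L²(0,1)²) ∩ C([0,T]; H¹(0,1)²)` of
`∂ₜ p + ∂ₓ u = 0`, `∂ₜ u + ∂ₓ p + a(u) = 0` on `(0,1) × (0,T)`,
`u(0,t) = g₀(t)`, `u(1,t) = g₁(t)`, `p(x,0) = c`, `u(x,0) = 0`.
Here `p x t` and `u x t` are the pointwise values of the representatives that are continuous in
`x ∈ [0,1]`; values outside `[0,1] × [0,T]` are irrelevant. -/
def IsClassicalSolution (T c : ℝ) (g₀ g₁ a : ℝ → ℝ) (p u : ℝ → ℝ → ℝ) : Prop :=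
  ∃ P U : ℝ → SobolevSpace 1 0 1,
    -- `p` and `u` represent the curves `P` and `U` in `H¹(0,1)`
    (∀ t ∈ Icc 0 T, ContinuousOn (fun x => p x t) (Icc 0 1) ∧
      weakDerivL2 0 (P t) =ᵐ[volume.restrict (Ioo (0 : ℝ) 1)] fun x => p x t) ∧
    (∀ t ∈ Icc 0 T, ContinuousOn (fun x => u x t) (Icc 0 1) ∧
      weakDerivL2 0 (U t) =ᵐ[volume.restrict (Ioo (0 : ℝ) 1)] fun x => u x t) ∧
    -- regularity
    ContinuousOn P (Icc 0 T) ∧ ContinuousOn U (Icc 0 T) ∧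
    ContDiffOn ℝ 1 (fun t => weakDerivL2 0 (P t)) (Icc 0 T) ∧
    ContDiffOn ℝ 1 (fun t => weakDerivL2 0 (U t)) (Icc 0 T) ∧
    -- differential equations, as identities in `L²(0,1)`
    (∀ t ∈ Icc 0 T, ∀ᵐ x ∂(volume.restrict (Ioo (0 : ℝ) 1)),
      derivWithin (fun s => weakDerivL2 0 (P s)) (Icc 0 T) t x + weakDerivL2 1 (U t) x = 0) ∧
    (∀ t ∈ Icc 0 T, ∀ᵐ x ∂(volume.restrict (Ioo (0 : ℝ) 1)),
      derivWithin (fun s => weakDerivL2 0 (U s)) (Icc 0 T) t x + weakDerivL2 1 (P t) x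
        + a (u x t) = 0) ∧
    -- boundary and initial conditions
    (∀ t ∈ Icc 0 T, u 0 t = g₀ t ∧ u 1 t = g₁ t) ∧
    (∀ x ∈ Icc 0 1, p x 0 = c ∧ u x 0 = 0)

/-- The conditions on the damping law: `a ∈ W^{3,∞}_loc(ℝ)` (identified with its continuous
representative), `a(0) = 0`, `a₀ ≤ a' ≤ a₁`, `|a''| ≤ a₂` and `|a'''| ≤ a₃`.
The bounds on the weak derivatives `a', a'', a'''` hold almost everywhere and contain their local
essential boundedness. -/
def IsAdmissibleDamping (a₀ a₁ a₂ a₃ : ℝ) (a : ℝ → ℝ) : Prop :=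
  Continuous a ∧ a 0 = 0 ∧ ∃ d₁ d₂ d₃ : ℝ → ℝ,
    HasWeakDeriv univ a d₁ ∧ HasWeakDeriv univ d₁ d₂ ∧ HasWeakDeriv univ d₂ d₃ ∧
    (∀ᵐ ξ, a₀ ≤ d₁ ξ ∧ d₁ ξ ≤ a₁) ∧ (∀ᵐ ξ, |d₂ ξ| ≤ a₂) ∧ (∀ᵐ ξ, |d₃ ξ| ≤ a₃)

/-- Conditions on the boundary data: `g ∈ C⁴([0,T])`, `g(0) = 0`, `g'(0) = 0`. -/
def IsAdmissibleBoundaryData (T : ℝ) (g : ℝ → ℝ) : Prop :=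
  ContDiffOn ℝ 4 g (Icc 0 T) ∧ g 0 = 0 ∧ derivWithin g (Icc 0 T) 0 = 0

/-- `ul ≤ u(x,t) ≤ uu` on `[0,1] × [0,T]`, uniformly for all admissible damping laws. -/
def AreVelocityBounds (T c : ℝ) (g₀ g₁ : ℝ → ℝ) (a₀ a₁ a₂ a₃ ul uu : ℝ) : Prop :=
  ∀ (a : ℝ → ℝ) (p u : ℝ → ℝ → ℝ), IsAdmissibleDamping a₀ a₁ a₂ a₃ a →
    IsClassicalSolution T c g₀ g₁ a p u →
    ∀ x ∈ Icc (0 : ℝ) 1, ∀ t ∈ Icc 0 T, ul ≤ u x t ∧ u x t ≤ uu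

/-- The domain `D(F)`: elements of `H²(ul, uu)` that are restrictions to `(ul, uu)` of admissible
damping laws. -/
def forwardDomain (a₀ a₁ a₂ a₃ ul uu : ℝ) : Set (SobolevSpace 2 ul uu) :=
  {a | ∃ b : ℝ → ℝ, IsAdmissibleDamping a₀ a₁ a₂ a₃ b ∧
    weakDerivL2 0 a =ᵐ[volume.restrict (Ioo ul uu)] b}

/-- `y ∈ L²(0,T)` is the pressure drop `p(0,·) - p(1,·)` of a classical solution for the damping
parameter `a ∈ H²(ul, uu)`, that is, for an admissible damping law with restriction `a`. -/
def IsPressureDrop (T c : ℝ) (g₀ g₁ : ℝ → ℝ) (a₀ a₁ a₂ a₃ ul uu : ℝ)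
    (a : SobolevSpace 2 ul uu) (y : L2Interval 0 T) : Prop :=
  ∃ (b : ℝ → ℝ) (p u : ℝ → ℝ → ℝ), IsAdmissibleDamping a₀ a₁ a₂ a₃ b ∧
    weakDerivL2 0 a =ᵐ[volume.restrict (Ioo ul uu)] b ∧
    IsClassicalSolution T c g₀ g₁ b p u ∧
    y =ᵐ[volume.restrict (Ioo 0 T)] fun t => p 0 t - p 1 t

open Classical in
/-- The forward operator `F : D(F) ⊆ H²(ul, uu) → L²(0,T)`, `a ↦ p(0,·) - p(1,·)`; it has the junk
value `0` where no pressure drop exists. -/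
noncomputable def forwardOperator (T c : ℝ) (g₀ g₁ : ℝ → ℝ) (a₀ a₁ a₂ a₃ ul uu : ℝ)
    (a : SobolevSpace 2 ul uu) : L2Interval 0 T :=
  if h : ∃ y, IsPressureDrop T c g₀ g₁ a₀ a₁ a₂ a₃ ul uu a y then h.choose else 0

/-! The source of compactness is the class of admissible laws itself. Written for jets (b, b', b''),
its conditions are bounds and Taylor inequalities that survive pointwise limits (`IsDampingJet`),
and every b(x) is bounded uniformly over the class because b(0) = 0 and 0 ≤ b' ≤ a₁. Along any
ultrafilter a family of laws therefore converges pointwise to an admissible law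
(`IsDampingJet.exists_ultrafilter_limit`), and the common Lipschitz constant makes this uniform on
compact sets.

The pressure drop is continuous for this convergence (`tendsto_pressureDrop`). Solutions are written
by Duhamel's formula along characteristics, after reflection at both ends. In norms weighted by
exp(-μt) the Duhamel operator has size 1/μ, which absorbs the Lipschitz constant of b for large μ
(`IsMildSolution.abs_pressure_sub_le`). Hence the pressure drops of all admissible laws form a
compact set (`isCompact_pressureDrops`), and it contains F(D(F)). For weakly convergent parameters,
the pointwise limit law is also a strong L² limit on the velocity interval, so it restricts to the
weak limit.

F is well defined because solutions for a monotone law are unique, by an energy estimate, and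
because two laws with the same restriction agree on the closed velocity interval and so have the
same solutions. For existence, an explicit d'Alembert wave carries the boundary data. The source
b(u) need not vanish at the ends, so its odd extension jumps and is not differentiated in x. Instead
V = ∂ₜu is found by contraction (`exists_velocityRate`), and x-derivatives are recovered from the
transport equation (`hasDerivAt_duhamel_space`). The bound on V is uniform over the class and yields
velocity bounds. -/

/-! ### Weak derivatives on an interval: primitives and the product rule -/

theorem IsCompact.exists_subset_Ioo {I K : Set ℝ} (hI : IsOpen I) (hne : I.Nonempty)
    (hK : IsCompact K) (hKI : K ⊆ I) :
    ∃ α ∈ I, ∃ β ∈ I, α < β ∧ K ⊆ Ioo α β := by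
  have left : ∀ x ∈ I, ∃ y ∈ I, y < x := fun x hx =>
    ((Filter.Eventually.and (mem_nhdsWithin_of_mem_nhds (hI.mem_nhds hx))
      self_mem_nhdsWithin : ∀ᶠ y in 𝓝[<] x, y ∈ I ∧ y < x)).exists
  have right : ∀ x ∈ I, ∃ y ∈ I, x < y := fun x hx =>
    ((Filter.Eventually.and (mem_nhdsWithin_of_mem_nhds (hI.mem_nhds hx))
      self_mem_nhdsWithin : ∀ᶠ y in 𝓝[>] x, y ∈ I ∧ x < y)).exists
  rcases K.eq_empty_or_nonempty with rfl | hKne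
  · obtain ⟨x, hx⟩ := hne
    obtain ⟨y, hy, hyx⟩ := left x hx
    exact ⟨y, hy, x, hx, hyx, empty_subset _⟩
  · obtain ⟨m, hm, hmK⟩ := hK.exists_isLeast hKne
    obtain ⟨M, hM, hMK⟩ := hK.exists_isGreatest hKne
    obtain ⟨α, hα, hαm⟩ := left m (hKI hm)
    obtain ⟨β, hβ, hMβ⟩ := right M (hKI hM)
    exact ⟨α, hα, β, hβ, by linarith [hmK hM], fun x hx =>
      ⟨hαm.trans_le (hmK hx), (hMK hx).trans_lt hMβ⟩⟩

theorem setIntegral_eq_intervalIntegral_of_subset {I : Set ℝ} {α β : ℝ} {h : ℝ → ℝ}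
    (hm : MeasurableSet I) (hαβ : α ≤ β) (hI : Ioo α β ⊆ I)
    (hh : ∀ x ∉ Ioo α β, h x = 0) : ∫ x in I, h x = ∫ x in α..β, h x := by
  rw [intervalIntegral.integral_of_le hαβ, integral_Ioc_eq_integral_Ioo]
  exact setIntegral_eq_of_subset_of_forall_sdiff_eq_zero hm hI fun x hx => hh x hx.2

/-- An absolutely continuous function has its a.e. derivative as weak derivative. -/
theorem HasWeakDeriv.of_absolutelyContinuous {I : Set ℝ} (hI : IsOpen I) (hc : I.OrdConnected)
    {f g : ℝ → ℝ} (hf : LocallyIntegrableOn f I volume) (hg : LocallyIntegrableOn g I volume)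
    (hac : ∀ α ∈ I, ∀ β ∈ I, AbsolutelyContinuousOnInterval f α β)
    (hd : ∀ α ∈ I, ∀ β ∈ I, ∀ᵐ x, x ∈ uIcc α β → deriv f x = g x) : HasWeakDeriv I f g := by
  refine ⟨hf, hg, fun φ h1 h2 h3 => ?_⟩
  rcases I.eq_empty_or_nonempty with rfl | hne
  · simp
  obtain ⟨α, hα, β, hβ, hαβ, hsub⟩ := h2.isCompact.exists_subset_Ioo hI hne h3
  have hIoo : Ioo α β ⊆ I := Ioo_subset_Icc_self.trans (hc.out hα hβ)
  have h0 : ∀ x ∉ Ioo α β, φ x = 0 := fun x hx =>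
    image_eq_zero_of_notMem_tsupport fun h => hx (hsub h)
  have h0' : ∀ x ∉ Ioo α β, deriv φ x = 0 := fun x hx =>
    image_eq_zero_of_notMem_tsupport fun h =>
      hx (hsub (tsupport_deriv_subset (𝕜 := ℝ) (f := φ) h))
  rw [setIntegral_eq_intervalIntegral_of_subset hI.measurableSet hαβ.le hIoo
      (fun x hx => by simp [h0' x hx]),
    setIntegral_eq_intervalIntegral_of_subset hI.measurableSet hαβ.le hIoo
      (fun x hx => by simp [h0 x hx])]
  have hφ : AbsolutelyContinuousOnInterval φ α β :=
    (h1.of_le (by simp)).contDiffOn.absolutelyContinuousOnInterval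
  rw [(hac α hα β hβ).integral_mul_deriv_eq_deriv_mul hφ, h0 α (by simp), h0 β (by simp)]
  have : ∫ x in α..β, deriv f x * φ x = ∫ x in α..β, g x * φ x := by
    apply intervalIntegral.integral_congr_ae
    filter_upwards [hd α hα β hβ] with x hx hx'
    rw [hx (uIoc_subset_uIcc hx')]
  rw [this]
  simp

/-- The zero mean makes the primitive starting at α vanish again beyond β. -/
theorem exists_primitive_testFunction {α β : ℝ} {θ : ℝ → ℝ} (hθ : ContDiff ℝ ∞ θ)
    (hs : tsupport θ ⊆ Ioo α β) (h0 : ∫ x in α..β, θ x = 0) :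
    ∃ φ : ℝ → ℝ, ContDiff ℝ ∞ φ ∧ HasCompactSupport φ ∧ tsupport φ ⊆ Icc α β ∧ deriv φ = θ := by
  have hd : ∀ x, HasDerivAt (fun x => ∫ y in α..x, θ y) (θ x) x := fun x =>
    hθ.continuous.integral_hasStrictDerivAt α x |>.hasDerivAt
  have hder : deriv (fun x => ∫ y in α..x, θ y) = θ := funext fun x => (hd x).deriv
  have hz : ∀ x ∉ Ioo α β, θ x = 0 := fun x hx =>
    image_eq_zero_of_notMem_tsupport fun h => hx (hs h)
  have hsupp : tsupport (fun x => ∫ y in α..x, θ y) ⊆ Icc α β := by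
    refine closure_minimal (fun x hx => ?_) isClosed_Icc
    by_contra hx'
    apply hx
    rcases lt_or_ge x α with h | h
    · show ∫ y in α..x, θ y = 0
      rw [intervalIntegral.integral_congr (g := fun _ => 0)]
      · simp
      · intro y hy
        rw [uIcc_of_ge h.le] at hy
        exact hz y fun hy' => by linarith [hy.2, hy'.1]
    · have hβx : β < x := by
        by_contra h'
        exact hx' ⟨h, not_lt.1 h'⟩
      show ∫ y in α..x, θ y = 0
      rw [← intervalIntegral.integral_add_adjacent_intervals (b := β)
        (hθ.continuous.intervalIntegrable _ _) (hθ.continuous.intervalIntegrable _ _), h0,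
        intervalIntegral.integral_congr (a := β) (g := fun _ => 0)]
      · simp
      · intro y hy
        rw [uIcc_of_le hβx.le] at hy
        exact hz y fun hy' => by linarith [hy.1, hy'.2]
  refine ⟨_, contDiff_infty_iff_deriv.2 ⟨fun x => (hd x).differentiableAt, by rwa [hder]⟩,
    isCompact_Icc.of_isClosed_subset (isClosed_tsupport _) hsupp, hsupp, hder⟩

/-- A function with vanishing weak derivative on an interval is almost everywhere constant. -/
theorem HasWeakDeriv.ae_const {I : Set ℝ} (hI : IsOpen I) (hc : I.OrdConnected)
    {h : ℝ → ℝ} (hh : HasWeakDeriv I h fun _ => 0) :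
    ∃ c, h =ᵐ[volume.restrict I] fun _ => c := by
  rcases I.eq_empty_or_nonempty with rfl | ⟨x₀, hx₀⟩
  · exact ⟨0, by simp [Filter.EventuallyEq]⟩
  obtain ⟨r, hr, hrI⟩ := Metric.isOpen_iff.1 hI x₀ hx₀
  let η₀ : ContDiffBump x₀ := ⟨r / 4, r / 2, by positivity, by linarith⟩
  let η : ℝ → ℝ := η₀.normed volume
  have hη : ContDiff ℝ ∞ η := η₀.contDiff_normed
  have hηc : HasCompactSupport η := η₀.hasCompactSupport_normed
  have hηI : tsupport η ⊆ I := by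
    rw [η₀.tsupport_normed_eq]
    exact (Metric.closedBall_subset_ball (by show r / 2 < r; linarith)).trans hrI
  have hη1 : ∫ x, η x = 1 := η₀.integral_normed
  refine ⟨∫ x in I, h x * η x, ?_⟩
  set c := ∫ x in I, h x * η x with hcdef
  have key : ∀ᵐ x, x ∈ I → h x - c = 0 := by
    apply hI.ae_eq_zero_of_integral_contDiff_smul_eq_zero
    · exact hh.1.sub ((locallyIntegrable_const c).locallyIntegrableOn I)
    intro ψ hψ hψc hψI
    obtain ⟨α, hα, β, hβ, hαβ, hsub⟩ := (hψc.isCompact.union hηc.isCompact).exists_subset_Ioo hI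
      ⟨x₀, hx₀⟩ (union_subset hψI hηI)
    have hIoo : Ioo α β ⊆ I := Ioo_subset_Icc_self.trans (hc.out hα hβ)
    have zψ : ∀ x ∉ Ioo α β, ψ x = 0 := fun x hx =>
      image_eq_zero_of_notMem_tsupport fun h => hx (hsub (Or.inl h))
    have zη : ∀ x ∉ Ioo α β, η x = 0 := fun x hx =>
      image_eq_zero_of_notMem_tsupport fun h => hx (hsub (Or.inr h))
    set m := ∫ x in α..β, ψ x with hm
    have iη : ∫ x in α..β, η x = 1 := by
      rw [← setIntegral_eq_intervalIntegral_of_subset MeasurableSet.univ hαβ.le (subset_univ _) zη]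
      simpa using hη1
    -- du Bois-Reymond: subtracting m η from ψ leaves mean zero, hence the derivative of a test
    -- function, on which h vanishes by hypothesis.
    obtain ⟨φ, p1, p2, p3, p4⟩ := exists_primitive_testFunction
      (θ := fun x => ψ x - m * η x) (hψ.sub (contDiff_const.mul hη))
      (by
        refine (closure_mono (t := Function.support ψ ∪ Function.support η) ?_).trans ?_
        · intro x hx
          by_contra hx'
          simp only [mem_union, Function.mem_support, not_or, not_not] at hx'
          exact hx (by simp [hx'.1, hx'.2])
        · rw [closure_union]
          exact hsub)
      (by
        rw [intervalIntegral.integral_sub (hψ.continuous.intervalIntegrable _ _)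
          ((hη.continuous.const_mul m).intervalIntegrable _ _) ,
          intervalIntegral.integral_const_mul, iη, ← hm]
        ring)
    have := hh.integral_eq φ p1 p2 (p3.trans (hc.out hα hβ))
    rw [p4] at this
    have i1 := HasWeakDeriv.integrableOn_mul hh.1 hψ.continuous hψc hψI
    have i2 := HasWeakDeriv.integrableOn_mul hh.1 hη.continuous hηc hηI
    have i3 : IntegrableOn ψ I := (hψ.continuous.integrable_of_hasCompactSupport hψc).integrableOn
    have e1 : ∫ x in I, h x * (ψ x - m * η x) = (∫ x in I, h x * ψ x) - m * c := by
      rw [hcdef, ← integral_const_mul, ← integral_sub i1 (i2.const_mul m)]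
      congr 1; ext x; ring
    have e2 : ∫ x in I, ψ x = m :=
      setIntegral_eq_intervalIntegral_of_subset hI.measurableSet hαβ.le hIoo zψ
    have e3 : ∫ x, ψ x • (h x - c) = ∫ x in I, ψ x • (h x - c) := by
      symm
      apply setIntegral_eq_integral_of_forall_compl_eq_zero
      intro x hx
      rw [zψ x fun hx' => hx (hIoo hx'), zero_smul]
    have e4 : ∫ x in I, ψ x • (h x - c) = (∫ x in I, h x * ψ x) - c * m := by
      rw [← e2, ← integral_const_mul, ← integral_sub i1 (i3.const_mul c)]
      congr 1; ext x; simp only [smul_eq_mul]; ring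
    rw [e3, e4]
    rw [e1] at this
    simp at this
    linarith
  rw [Filter.EventuallyEq, ae_restrict_iff' hI.measurableSet]
  filter_upwards [key] with x hx hxI
  linarith [hx hxI]

theorem LocallyIntegrableOn.intervalIntegrable_of_mem {I : Set ℝ} (hc : I.OrdConnected)
    {g : ℝ → ℝ} (hg : LocallyIntegrableOn g I volume) {α β : ℝ} (hα : α ∈ I) (hβ : β ∈ I) :
    IntervalIntegrable g volume α β :=
  (intervalIntegrable_iff' (f := g)).2 <|
    hg.integrableOn_compact_subset (hc.uIcc_subset hα hβ) isCompact_uIcc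

/-- A function with a weak derivative is almost everywhere equal to a primitive of the latter. -/
theorem HasWeakDeriv.ae_eq_primitive {I : Set ℝ} (hI : IsOpen I) (hc : I.OrdConnected)
    {f g : ℝ → ℝ} (h : HasWeakDeriv I f g) {x₀ : ℝ} (hx₀ : x₀ ∈ I) :
    ∃ c, f =ᵐ[volume.restrict I] fun x => c + ∫ y in x₀..x, g y := by
  have hii : ∀ α ∈ I, ∀ β ∈ I, IntervalIntegrable g volume α β := fun α hα β hβ =>
    LocallyIntegrableOn.intervalIntegrable_of_mem hc h.2 hα hβ
  -- The facts on absolute continuity and a.e. differentiability of the primitive ask for the base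
  -- point x₀ inside the interval, so the interval is enlarged.
  have hbig : ∀ α ∈ I, ∀ β ∈ I, ∃ a ∈ I, ∃ b ∈ I, uIcc α β ⊆ uIcc a b ∧ x₀ ∈ uIcc a b := by
    intro α hα β hβ
    have hmin : ∀ x ∈ I, ∀ y ∈ I, min x y ∈ I := fun x hx y hy => by
      rcases min_choice x y with e | e <;> rw [e] <;> assumption
    have hmax : ∀ x ∈ I, ∀ y ∈ I, max x y ∈ I := fun x hx y hy => by
      rcases max_choice x y with e | e <;> rw [e] <;> assumption
    refine ⟨min (min α x₀) β, hmin _ (hmin _ hα _ hx₀) _ hβ,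
      max (max α x₀) β, hmax _ (hmax _ hα _ hx₀) _ hβ, ?_, ?_⟩
    · apply uIcc_subset_uIcc <;> (rw [mem_uIcc]; left; constructor <;> simp)
    · rw [mem_uIcc]; left; constructor <;> simp
  have hac : ∀ α ∈ I, ∀ β ∈ I,
      AbsolutelyContinuousOnInterval (fun x => ∫ y in x₀..x, g y) α β := by
    intro α hα β hβ
    obtain ⟨a, ha, b, hb, hsub, hx⟩ := hbig α hα β hβ
    exact ((hii a ha b hb).absolutelyContinuousOnInterval_intervalIntegral hx).mono hsub
  have hcont : ContinuousOn (fun x => ∫ y in x₀..x, g y) I := by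
    intro x hx
    obtain ⟨α, hα, β, hβ, _, hsub⟩ :=
      (isCompact_singleton (x := x)).exists_subset_Ioo hI ⟨x, hx⟩ (by simpa using hx)
    have hx' : x ∈ Ioo α β := hsub rfl
    refine ((hac α hα β hβ).continuousOn.continuousAt ?_).continuousWithinAt
    rw [uIcc_of_le (hx'.1.trans hx'.2).le]
    exact Icc_mem_nhds hx'.1 hx'.2
  have hF : HasWeakDeriv I (fun x => ∫ y in x₀..x, g y) g := by
    refine HasWeakDeriv.of_absolutelyContinuous hI hc
      (hcont.locallyIntegrableOn hI.measurableSet) h.2 hac ?_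
    intro α hα β hβ
    obtain ⟨a, ha, b, hb, hsub, hx₀'⟩ := hbig α hα β hβ
    filter_upwards [(hii a ha b hb).ae_hasDerivAt_integral] with x hx hx'
    exact (hx (hsub hx') x₀ hx₀').deriv
  have hz := (h.add (hF.const_mul (-1)))
  obtain ⟨c, hcc⟩ := HasWeakDeriv.ae_const hI hc
    (hz.congr (f₁ := fun x => f x + -1 * ∫ y in x₀..x, g y) (g₁ := fun _ => 0) (by rfl)
      (Eventually.of_forall fun x => by simp))
  refine ⟨c, ?_⟩
  filter_upwards [hcc] with x hx
  linarith

/-- Integrability of g up to the ends allows the base point to move from the interior to α, and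
continuity extends the a.e. identity to both endpoints. Boundary values thus become available. -/
theorem HasWeakDeriv.eqOn_primitive {α β : ℝ} (hαβ : α < β) {f g : ℝ → ℝ}
    (hf : ContinuousOn f (Icc α β)) (hg : IntegrableOn g (Ioo α β))
    (h : HasWeakDeriv (Ioo α β) f g) :
    ∃ c, EqOn f (fun x => c + ∫ y in α..x, g y) (Icc α β) := by
  have hgi : IntervalIntegrable g volume α β := by
    rw [intervalIntegrable_iff_integrableOn_Ioo_of_le hαβ.le]; exact hg
  obtain ⟨γ, hγ⟩ := exists_between hαβ
  have hγ' : γ ∈ uIcc α β := by rw [uIcc_of_le hαβ.le]; exact ⟨hγ.1.le, hγ.2.le⟩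
  obtain ⟨c, hc⟩ := h.ae_eq_primitive isOpen_Ioo ordConnected_Ioo hγ
  have hcont : ContinuousOn (fun x => c + ∫ y in γ..x, g y) (Icc α β) := by
    rw [← uIcc_of_le hαβ.le]
    exact continuousOn_const.add
      (hgi.absolutelyContinuousOnInterval_intervalIntegral hγ').continuousOn
  rw [Measure.restrict_congr_set Ioo_ae_eq_Icc] at hc
  have := Measure.eqOn_of_ae_eq hc hf hcont (by
    rw [interior_Icc, closure_Ioo hαβ.ne])
  refine ⟨c - ∫ y in α..γ, g y, fun x hx => ?_⟩
  rw [this hx]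
  have hx' : x ∈ uIcc α β := by rwa [uIcc_of_le hαβ.le]
  have := intervalIntegral.integral_add_adjacent_intervals (μ := volume)
    (hgi.mono_set (uIcc_subset_uIcc left_mem_uIcc hγ'))
    (hgi.mono_set (uIcc_subset_uIcc hγ' hx'))
  simp only
  linarith

/-- Product rule for functions in `W^{1,1}`. -/
theorem HasWeakDeriv.integral_product {α β : ℝ} (hαβ : α < β) {f g f' g' : ℝ → ℝ}
    (hf : ContinuousOn f (Icc α β)) (hg : ContinuousOn g (Icc α β))
    (hf' : IntegrableOn f' (Ioo α β)) (hg' : IntegrableOn g' (Ioo α β))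
    (hwf : HasWeakDeriv (Ioo α β) f f') (hwg : HasWeakDeriv (Ioo α β) g g') :
    ∫ x in Ioo α β, (f' x * g x + f x * g' x) = f β * g β - f α * g α := by
  obtain ⟨c, hc⟩ := hwf.eqOn_primitive hαβ hf hf'
  obtain ⟨d, hd⟩ := hwg.eqOn_primitive hαβ hg hg'
  have hfi : IntervalIntegrable f' volume α β := by
    rw [intervalIntegrable_iff_integrableOn_Ioo_of_le hαβ.le]; exact hf'
  have hgi : IntervalIntegrable g' volume α β := by
    rw [intervalIntegrable_iff_integrableOn_Ioo_of_le hαβ.le]; exact hg'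
  have ac : ∀ (e : ℝ) {k : ℝ → ℝ}, IntervalIntegrable k volume α β →
      AbsolutelyContinuousOnInterval (fun x => e + ∫ y in α..x, k y) α β := by
    intro e k hk
    exact (contDiff_const.contDiffOn.absolutelyContinuousOnInterval).add
      (hk.absolutelyContinuousOnInterval_intervalIntegral left_mem_uIcc)
  have key := (ac c hfi).integral_deriv_mul_eq_sub (ac d hgi)
  rw [← integral_Ioc_eq_integral_Ioo, ← intervalIntegral.integral_of_le hαβ.le]
  rw [hc (right_mem_Icc.2 hαβ.le), hc (left_mem_Icc.2 hαβ.le), hd (right_mem_Icc.2 hαβ.le),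
    hd (left_mem_Icc.2 hαβ.le), ← key]
  apply intervalIntegral.integral_congr_ae
  filter_upwards [hfi.ae_hasDerivAt_integral, hgi.ae_hasDerivAt_integral] with x h1 h2 hx
  have hx' := uIoc_subset_uIcc hx
  have hx'' : x ∈ Icc α β := by rwa [uIcc_of_le hαβ.le] at hx'
  rw [((h1 hx' α left_mem_uIcc).const_add c).deriv, ((h2 hx' α left_mem_uIcc).const_add d).deriv,
    hc hx'', hd hx'']

theorem LipschitzWith.hasWeakDeriv {C : NNReal} {f : ℝ → ℝ} (hf : LipschitzWith C f) :
    HasWeakDeriv univ f (deriv f) := by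
  refine HasWeakDeriv.of_absolutelyContinuous isOpen_univ ordConnected_univ
    (hf.continuous.locallyIntegrable.locallyIntegrableOn _) ?_
    (fun α _ β _ => hf.lipschitzOnWith.absolutelyContinuousOnInterval)
    (fun α _ β _ => Eventually.of_forall fun x _ => rfl)
  refine LocallyIntegrable.locallyIntegrableOn ?_ _
  refine (locallyIntegrable_const (C : ℝ)).mono (measurable_deriv f).aestronglyMeasurable ?_
  refine Eventually.of_forall fun x => ?_
  simpa using norm_deriv_le_of_lipschitz hf

/-! ### Admissible damping laws as jets, and their compactness -/

/-- Pointwise form of `IsAdmissibleDamping`: `b₁` and `b₂` are the first two derivatives of `b`. The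
bounds are preserved by pointwise limits. -/
structure IsDampingJet (a₀ a₁ a₂ a₃ : ℝ) (b b₁ b₂ : ℝ → ℝ) : Prop where
  zero : b 0 = 0
  lower : ∀ x, a₀ ≤ b₁ x
  upper : ∀ x, b₁ x ≤ a₁
  bound : ∀ x, |b₂ x| ≤ a₂
  taylor : ∀ x y, |b y - b x - b₁ x * (y - x)| ≤ a₂ * (y - x) ^ 2
  taylor_deriv : ∀ x y, |b₁ y - b₁ x - b₂ x * (y - x)| ≤ a₃ * (y - x) ^ 2
  lipschitz : ∀ x y, |b₂ y - b₂ x| ≤ a₃ * |y - x|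

theorem hasDerivAt_of_abs_sub_le_sq {f : ℝ → ℝ} {f' x C : ℝ}
    (h : ∀ y, |f y - f x - f' * (y - x)| ≤ C * (y - x) ^ 2) : HasDerivAt f f' x := by
  rw [hasDerivAt_iff_isLittleO]
  have h1 : (fun y => f y - f x - (y - x) • f') =O[𝓝 x] fun y => (y - x) ^ 2 := by
    refine Asymptotics.IsBigO.of_bound C (Eventually.of_forall fun y => ?_)
    rw [Real.norm_eq_abs, Real.norm_eq_abs, abs_of_nonneg (sq_nonneg (y - x)), smul_eq_mul,
      mul_comm]
    exact h y
  refine h1.trans_isLittleO ?_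
  have h2 : (fun y => y - x) =o[𝓝 x] fun _ => (1 : ℝ) := by
    rw [Asymptotics.isLittleO_one_iff]
    have : Tendsto (fun y => y - x) (𝓝 x) (𝓝 (x - x)) := (continuous_sub_right x).tendsto x
    simpa using this
  simpa [sq] using h2.mul_isBigO (Asymptotics.isBigO_refl (fun y => y - x) (𝓝 x))

/-- The crude constant C in place of C/2 is harmless: the Taylor inequality only has to encode
differentiability in a form stable under limits. -/
theorem abs_primitive_taylor_le {f : ℝ → ℝ} (hf : Continuous f) {C : ℝ} (hC : 0 ≤ C)
    (hl : ∀ x y, |f y - f x| ≤ C * |y - x|) (x y : ℝ) :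
    |(∫ s in x..y, f s) - f x * (y - x)| ≤ C * (y - x) ^ 2 := by
  have e : (∫ s in x..y, f s) - f x * (y - x) = ∫ s in x..y, (f s - f x) := by
    rw [intervalIntegral.integral_sub (hf.intervalIntegrable _ _) (by simp)]
    simp [mul_comm]
  rw [e, ← sq_abs (y - x), sq, ← mul_assoc, ← Real.norm_eq_abs]
  refine intervalIntegral.norm_integral_le_of_norm_le_const fun s hs => ?_
  refine (hl x s).trans (mul_le_mul_of_nonneg_left ?_ hC)
  exact abs_sub_left_of_mem_uIcc (uIoc_subset_uIcc hs)

theorem HasWeakDeriv.exists_continuous_primitive {f g : ℝ → ℝ} (h : HasWeakDeriv univ f g) :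
    ∃ F : ℝ → ℝ, Continuous F ∧ f =ᵐ[volume] F ∧ ∀ x y, F y - F x = ∫ s in x..y, g s := by
  obtain ⟨c, hc⟩ := h.ae_eq_primitive isOpen_univ ordConnected_univ (mem_univ (0 : ℝ))
  have hi : ∀ x y, IntervalIntegrable g volume x y := fun x y =>
    LocallyIntegrableOn.intervalIntegrable_of_mem ordConnected_univ h.2 (mem_univ _) (mem_univ _)
  refine ⟨fun x => c + ∫ y in (0 : ℝ)..x, g y,
    continuous_const.add (intervalIntegral.continuous_primitive hi 0),
    by simpa using hc, fun x y => ?_⟩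
  rw [add_sub_add_left_eq_sub, intervalIntegral.integral_interval_sub_left (hi _ _) (hi _ _)]

theorem forall_of_ae_of_isClosed {p : ℝ → Prop} (h : ∀ᵐ x, p x) (hc : IsClosed {x | p x}) (x : ℝ) :
    p x := by
  have := (Measure.dense_of_ae h).closure_eq
  rw [hc.closure_eq] at this
  exact this.ge (mem_univ x)

/-- The weak derivatives have continuous representatives, for which bounds that hold almost
everywhere hold everywhere by density. The Taylor inequalities follow by integrating the Lipschitz
bounds. -/
theorem IsAdmissibleDamping.exists_jet {a₀ a₁ a₂ a₃ : ℝ} (ha₂ : 0 ≤ a₂) (ha₃ : 0 ≤ a₃)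
    {b : ℝ → ℝ} (hb : IsAdmissibleDamping a₀ a₁ a₂ a₃ b) :
    ∃ b₁ b₂, IsDampingJet a₀ a₁ a₂ a₃ b b₁ b₂ := by
  obtain ⟨hc, h0, d₁, d₂, d₃, w₁, w₂, w₃, e₁, e₂, e₃⟩ := hb
  obtain ⟨F, cF, hF, iF⟩ := w₁.exists_continuous_primitive
  obtain ⟨F₁, cF₁, hF₁, iF₁⟩ := w₂.exists_continuous_primitive
  obtain ⟨F₂, cF₂, hF₂, iF₂⟩ := w₃.exists_continuous_primitive
  have hbF : b = F := (hc.ae_eq_iff_eq volume cF).1 hF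
  subst hbF
  have bd₁ : ∀ x, a₀ ≤ F₁ x ∧ F₁ x ≤ a₁ := forall_of_ae_of_isClosed
    (by filter_upwards [e₁, hF₁] with x h1 h2; rwa [← h2])
    ((isClosed_le continuous_const cF₁).inter (isClosed_le cF₁ continuous_const))
  have bd₂ : ∀ x, |F₂ x| ≤ a₂ := forall_of_ae_of_isClosed
    (by filter_upwards [e₂, hF₂] with x h1 h2; rwa [← h2])
    (isClosed_le cF₂.abs continuous_const)
  have i : ∀ x y, b y - b x = ∫ s in x..y, F₁ s := fun x y => by
    rw [iF]; exact intervalIntegral.integral_congr_ae (hF₁.mono fun x hx _ => hx)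
  have i₁ : ∀ x y, F₁ y - F₁ x = ∫ s in x..y, F₂ s := fun x y => by
    rw [iF₁]; exact intervalIntegral.integral_congr_ae (hF₂.mono fun x hx _ => hx)
  have l₂ : ∀ x y, |F₂ y - F₂ x| ≤ a₃ * |y - x| := fun x y => by
    rw [iF₂, ← Real.norm_eq_abs]
    exact intervalIntegral.norm_integral_le_of_norm_le_const_ae (e₃.mono fun x hx _ => hx)
  have l₁ : ∀ x y, |F₁ y - F₁ x| ≤ a₂ * |y - x| := fun x y => by
    rw [i₁, ← Real.norm_eq_abs]
    exact intervalIntegral.norm_integral_le_of_norm_le_const fun x _ => bd₂ x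
  refine ⟨F₁, F₂, h0, fun x => (bd₁ x).1, fun x => (bd₁ x).2, bd₂, fun x y => ?_, fun x y => ?_, l₂⟩
  · rw [i]; exact abs_primitive_taylor_le cF₁ ha₂ l₁ x y
  · rw [i₁]; exact abs_primitive_taylor_le cF₂ ha₃ l₂ x y

namespace IsDampingJet

variable {a₀ a₁ a₂ a₃ : ℝ} {b b₁ b₂ : ℝ → ℝ}

theorem hasDerivAt (h : IsDampingJet a₀ a₁ a₂ a₃ b b₁ b₂) (x : ℝ) : HasDerivAt b (b₁ x) x :=
  hasDerivAt_of_abs_sub_le_sq (h.taylor x)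

theorem hasDerivAt_deriv (h : IsDampingJet a₀ a₁ a₂ a₃ b b₁ b₂) (x : ℝ) :
    HasDerivAt b₁ (b₂ x) x :=
  hasDerivAt_of_abs_sub_le_sq (h.taylor_deriv x)

theorem abs_deriv_le (h : IsDampingJet a₀ a₁ a₂ a₃ b b₁ b₂) (ha₀ : 0 ≤ a₀) (x : ℝ) :
    |b₁ x| ≤ a₁ := by
  rw [abs_of_nonneg (ha₀.trans (h.lower x))]
  exact h.upper x

theorem abs_sub_le (h : IsDampingJet a₀ a₁ a₂ a₃ b b₁ b₂) (ha₀ : 0 ≤ a₀) (x y : ℝ) :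
    |b y - b x| ≤ a₁ * |y - x| := by
  have := convex_univ.norm_image_sub_le_of_norm_hasDerivWithin_le (f := b) (f' := b₁) (C := a₁)
    (fun x _ => (h.hasDerivAt x).hasDerivWithinAt) (fun x _ => h.abs_deriv_le ha₀ x)
    (mem_univ x) (mem_univ y)
  simpa using this

theorem abs_deriv_sub_le (h : IsDampingJet a₀ a₁ a₂ a₃ b b₁ b₂) (x y : ℝ) :
    |b₁ y - b₁ x| ≤ a₂ * |y - x| := by
  have := convex_univ.norm_image_sub_le_of_norm_hasDerivWithin_le (f := b₁) (f' := b₂) (C := a₂)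
    (fun x _ => (h.hasDerivAt_deriv x).hasDerivWithinAt) (fun x _ => h.bound x)
    (mem_univ x) (mem_univ y)
  simpa using this

theorem isAdmissibleDamping (h : IsDampingJet a₀ a₁ a₂ a₃ b b₁ b₂) (ha₀ : 0 ≤ a₀) :
    IsAdmissibleDamping a₀ a₁ a₂ a₃ b := by
  have lip : ∀ {f : ℝ → ℝ} {C : ℝ}, (∀ x y, |f y - f x| ≤ C * |y - x|) →
      LipschitzWith C.toNNReal f := by
    intro f C hf
    have hC : 0 ≤ C := by simpa using (abs_nonneg _).trans (hf 0 1)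
    refine LipschitzWith.of_dist_le_mul fun x y => ?_
    rw [Real.coe_toNNReal _ hC, Real.dist_eq, Real.dist_eq]
    exact hf y x
  have e : deriv b = b₁ := funext fun x => (h.hasDerivAt x).deriv
  have e₁ : deriv b₁ = b₂ := funext fun x => (h.hasDerivAt_deriv x).deriv
  have l := lip (h.abs_sub_le ha₀)
  have l₁ := lip h.abs_deriv_sub_le
  have l₂ := lip h.lipschitz
  have w := l.hasWeakDeriv
  have w₁ := l₁.hasWeakDeriv
  rw [e] at w
  rw [e₁] at w₁
  refine ⟨l.continuous, h.zero, b₁, b₂, deriv b₂, w, w₁, l₂.hasWeakDeriv,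
    Eventually.of_forall fun x => ⟨h.lower x, h.upper x⟩, Eventually.of_forall h.bound,
    Eventually.of_forall fun x => ?_⟩
  have hC : 0 ≤ a₃ := by simpa using (abs_nonneg _).trans (h.lipschitz 0 1)
  simpa [Real.coe_toNNReal _ hC] using norm_deriv_le_of_lipschitz l₂ (x₀ := x)

/-- Admissible damping laws are compact for pointwise convergence. -/
theorem exists_ultrafilter_limit {ι : Type*} (U : Ultrafilter ι) {b b₁ b₂ : ι → ℝ → ℝ}
    (ha₀ : 0 ≤ a₀) (h : ∀ᶠ i in U, IsDampingJet a₀ a₁ a₂ a₃ (b i) (b₁ i) (b₂ i)) :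
    ∃ c c₁ c₂, IsDampingJet a₀ a₁ a₂ a₃ c c₁ c₂ ∧ ∀ x, Tendsto (fun i => b i x) U (𝓝 (c x)) := by
  -- Bounded real families converge along an ultrafilter, so no diagonal extraction of subsequences
  -- is needed.
  have lim : ∀ (f : ι → ℝ) (C : ℝ), (∀ᶠ i in U, |f i| ≤ C) → ∃ y, Tendsto f U (𝓝 y) := by
    intro f C hf
    have : ((U.map f : Ultrafilter ℝ) : Filter ℝ) ≤ 𝓟 (Icc (-C) C) := by
      rw [le_principal_iff]
      exact hf.mono fun i hi => abs_le.1 hi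
    obtain ⟨y, _, hy⟩ := isCompact_Icc.ultrafilter_le_nhds _ this
    exact ⟨y, hy⟩
  have l : ∀ x, ∃ y, Tendsto (fun i => b i x) U (𝓝 y) := fun x =>
    lim _ (a₁ * |x|) (h.mono fun i hi => by simpa [hi.zero] using hi.abs_sub_le ha₀ 0 x)
  have l₁ : ∀ x, ∃ y, Tendsto (fun i => b₁ i x) U (𝓝 y) := fun x =>
    lim _ a₁ (h.mono fun i hi => hi.abs_deriv_le ha₀ x)
  have l₂ : ∀ x, ∃ y, Tendsto (fun i => b₂ i x) U (𝓝 y) := fun x =>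
    lim _ a₂ (h.mono fun i hi => hi.bound x)
  choose c hc using l
  choose c₁ hc₁ using l₁
  choose c₂ hc₂ using l₂
  refine ⟨c, c₁, c₂, ⟨?_, fun x => ?_, fun x => ?_, fun x => ?_, fun x y => ?_, fun x y => ?_,
    fun x y => ?_⟩, hc⟩
  · exact tendsto_nhds_unique (hc 0) (tendsto_const_nhds.congr' (h.mono fun i hi => hi.zero.symm))
  · exact ge_of_tendsto (hc₁ x) (h.mono fun i hi => hi.lower x)
  · exact le_of_tendsto (hc₁ x) (h.mono fun i hi => hi.upper x)
  · exact le_of_tendsto (hc₂ x).abs (h.mono fun i hi => hi.bound x)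
  · exact le_of_tendsto ((((hc y).sub (hc x)).sub ((hc₁ x).mul_const _)).abs)
      (h.mono fun i hi => hi.taylor x y)
  · exact le_of_tendsto ((((hc₁ y).sub (hc₁ x)).sub ((hc₂ x).mul_const _)).abs)
      (h.mono fun i hi => hi.taylor_deriv x y)
  · exact le_of_tendsto (((hc₂ y).sub (hc₂ x)).abs) (h.mono fun i hi => hi.lipschitz x y)

end IsDampingJet

/-! ### Energy estimate and uniqueness -/

theorem SobolevSpace.hasWeakDeriv {α β : ℝ} (f : SobolevSpace 1 α β) :
    HasWeakDeriv (Ioo α β) (weakDerivL2 0 f) (weakDerivL2 1 f) := f.2 0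

theorem weakDerivL2_sub {k : ℕ} {α β : ℝ} (j : Fin (k + 1)) (f g : SobolevSpace k α β) :
    weakDerivL2 j (f - g) = weakDerivL2 j f - weakDerivL2 j g := rfl

theorem L2Interval.integrableOn {α β : ℝ} (f : L2Interval α β) : IntegrableOn f (Ioo α β) :=
  (Lp.memLp f).integrable (by norm_num)

theorem SobolevSpace.integral_product {α β : ℝ} (hαβ : α < β) (F G : SobolevSpace 1 α β)
    {f g : ℝ → ℝ} (hf : ContinuousOn f (Icc α β)) (hg : ContinuousOn g (Icc α β))
    (hF : weakDerivL2 0 F =ᵐ[volume.restrict (Ioo α β)] f)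
    (hG : weakDerivL2 0 G =ᵐ[volume.restrict (Ioo α β)] g) :
    ∫ x in Ioo α β, (weakDerivL2 1 F x * g x + f x * weakDerivL2 1 G x) =
      f β * g β - f α * g α :=
  HasWeakDeriv.integral_product hαβ hf hg (L2Interval.integrableOn _) (L2Interval.integrableOn _)
    ((SobolevSpace.hasWeakDeriv F).congr hF (by rfl))
    ((SobolevSpace.hasWeakDeriv G).congr hG (by rfl))

theorem L2Interval.inner_eq {α β : ℝ} (f g : L2Interval α β) :
    inner ℝ f g = ∫ x in Ioo α β, g x * f x := by
  rw [L2.inner_def]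
  rfl

theorem L2Interval.integrableOn_mul {α β : ℝ} (f g : L2Interval α β) :
    IntegrableOn (fun x => g x * f x) (Ioo α β) :=
  L2.integrable_inner f g

/-- Dissipation of energy for the damped wave system with homogeneous boundary values. -/
theorem SobolevSpace.energy_rate_nonpos {P U : SobolevSpace 1 0 1} {q w k : ℝ → ℝ}
    {Pd Ud : L2Interval 0 1} (hq : ContinuousOn q (Icc 0 1)) (hw : ContinuousOn w (Icc 0 1))
    (hP : weakDerivL2 0 P =ᵐ[volume.restrict (Ioo (0 : ℝ) 1)] q)
    (hU : weakDerivL2 0 U =ᵐ[volume.restrict (Ioo (0 : ℝ) 1)] w)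
    (w0 : w 0 = 0) (w1 : w 1 = 0)
    (aP : Pd =ᵐ[volume.restrict (Ioo (0 : ℝ) 1)] fun x => - weakDerivL2 1 U x)
    (aU : Ud =ᵐ[volume.restrict (Ioo (0 : ℝ) 1)] fun x => - weakDerivL2 1 P x - k x)
    (hk : ∀ x, 0 ≤ k x * w x) :
    inner ℝ (weakDerivL2 0 P) Pd + inner ℝ (weakDerivL2 0 U) Ud ≤ 0 := by
  have key := SobolevSpace.integral_product one_pos P U hq hw hP hU
  rw [w0, w1, mul_zero, mul_zero, sub_zero] at key
  rw [L2Interval.inner_eq, L2Interval.inner_eq,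
    ← integral_add (L2Interval.integrableOn_mul _ _) (L2Interval.integrableOn_mul _ _)]
  -- By `key` the flux terms integrate to zero, since w vanishes at both ends. Comparing whole
  -- integrands then leaves the sign of k w, without asking that k w be integrable separately.
  refine le_of_le_of_eq ?_ (neg_eq_zero.2 key)
  rw [← integral_neg]
  have i1 := (L2Interval.integrableOn_mul (weakDerivL2 0 U) (weakDerivL2 1 P)).add
    (L2Interval.integrableOn_mul (weakDerivL2 1 U) (weakDerivL2 0 P))
  refine integral_mono_ae ((L2Interval.integrableOn_mul _ _).add
    (L2Interval.integrableOn_mul _ _)) (i1.congr ?_).neg ?_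
  · filter_upwards [hP, hU] with x h1 h2
    simp only [Pi.add_apply]
    rw [h1, h2]
  · filter_upwards [hP, hU, aP, aU] with x h1 h2 h3 h4
    rw [h1, h2, h3, h4]
    have := hk x
    linarith

/-- The difference of two solutions has homogeneous data, and monotonicity of b gives (b(u) -
b(u'))(u - u') ≥ 0. Its energy is therefore nonincreasing, starts at zero and stays zero. -/
theorem IsClassicalSolution.unique {T c : ℝ} {g₀ g₁ b : ℝ → ℝ} {p u p' u' : ℝ → ℝ → ℝ}
    (hT : 0 < T) (hmono : Monotone b)
    (h : IsClassicalSolution T c g₀ g₁ b p u) (h' : IsClassicalSolution T c g₀ g₁ b p' u')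
    {t x : ℝ} (ht : t ∈ Icc 0 T) (hx : x ∈ Icc (0 : ℝ) 1) :
    p x t = p' x t ∧ u x t = u' x t := by
  obtain ⟨P, U, hP, hU, -, -, dP, dU, e₁, e₂, bc, ic⟩ := h
  obtain ⟨P', U', hP', hU', -, -, dP', dU', e₁', e₂', bc', ic'⟩ := h'
  let Q : ℝ → L2Interval 0 1 := fun t => weakDerivL2 0 (P t) - weakDerivL2 0 (P' t)
  let W : ℝ → L2Interval 0 1 := fun t => weakDerivL2 0 (U t) - weakDerivL2 0 (U' t)
  have hQ : ∀ t ∈ Icc 0 T, Q t =ᵐ[volume.restrict (Ioo (0 : ℝ) 1)] fun x => p x t - p' x t := by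
    intro t ht
    filter_upwards [(hP t ht).2, (hP' t ht).2,
      Lp.coeFn_sub (weakDerivL2 0 (P t)) (weakDerivL2 0 (P' t))] with x h1 h2 h3
    simp only [Q]
    rw [h3, Pi.sub_apply, h1, h2]
  have hW : ∀ t ∈ Icc 0 T, W t =ᵐ[volume.restrict (Ioo (0 : ℝ) 1)] fun x => u x t - u' x t := by
    intro t ht
    filter_upwards [(hU t ht).2, (hU' t ht).2,
      Lp.coeFn_sub (weakDerivL2 0 (U t)) (weakDerivL2 0 (U' t))] with x h1 h2 h3
    simp only [W]
    rw [h3, Pi.sub_apply, h1, h2]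
  have cQ : ContinuousOn Q (Icc 0 T) := dP.continuousOn.sub dP'.continuousOn
  have cW : ContinuousOn W (Icc 0 T) := dU.continuousOn.sub dU'.continuousOn
  let E : ℝ → ℝ := fun t => ‖Q t‖ ^ 2 + ‖W t‖ ^ 2
  have cE : ContinuousOn E (Icc 0 T) := (cQ.norm.pow 2).add (cW.norm.pow 2)
  have hderiv : ∀ {X X' : ℝ → L2Interval 0 1}, ContDiffOn ℝ 1 X (Icc 0 T) →
      ContDiffOn ℝ 1 X' (Icc 0 T) → ∀ t ∈ Ioo 0 T, HasDerivAt (fun s => X s - X' s)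
        (derivWithin X (Icc 0 T) t - derivWithin X' (Icc 0 T) t) t := by
    intro X X' hX hX' t ht
    have hn := Icc_mem_nhds ht.1 ht.2
    have ht' := Ioo_subset_Icc_self ht
    exact ((hX.differentiableOn one_ne_zero t ht').hasDerivWithinAt.hasDerivAt hn).sub
      ((hX'.differentiableOn one_ne_zero t ht').hasDerivWithinAt.hasDerivAt hn)
  have hE : ∀ t ∈ Ioo 0 T, ∃ e ≤ 0, HasDerivAt E e t := by
    intro t ht
    have ht' := Ioo_subset_Icc_self ht
    have dQ := hderiv dP dP' t ht
    have dW := hderiv dU dU' t ht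
    obtain ⟨Qd, hQd⟩ : ∃ Qd, Qd = derivWithin (fun s => weakDerivL2 0 (P s)) (Icc 0 T) t -
      derivWithin (fun s => weakDerivL2 0 (P' s)) (Icc 0 T) t := ⟨_, rfl⟩
    obtain ⟨Wd, hWd⟩ : ∃ Wd, Wd = derivWithin (fun s => weakDerivL2 0 (U s)) (Icc 0 T) t -
      derivWithin (fun s => weakDerivL2 0 (U' s)) (Icc 0 T) t := ⟨_, rfl⟩
    rw [← hQd] at dQ
    rw [← hWd] at dW
    refine ⟨_, ?_, (dQ.norm_sq).add (dW.norm_sq)⟩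
    show 2 * inner ℝ (Q t) Qd + 2 * inner ℝ (W t) Wd ≤ 0
    have aQ : Qd =ᵐ[volume.restrict (Ioo (0 : ℝ) 1)] fun x => - weakDerivL2 1 (U t - U' t) x := by
      filter_upwards [e₁ t ht', e₁' t ht', Lp.coeFn_sub
        (derivWithin (fun s => weakDerivL2 0 (P s)) (Icc 0 T) t)
        (derivWithin (fun s => weakDerivL2 0 (P' s)) (Icc 0 T) t),
        Lp.coeFn_sub (weakDerivL2 1 (U t)) (weakDerivL2 1 (U' t))] with x h1 h2 h3 h4
      rw [hQd, h3, weakDerivL2_sub, h4, Pi.sub_apply, Pi.sub_apply]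
      linarith
    have aW : Wd =ᵐ[volume.restrict (Ioo (0 : ℝ) 1)]
        fun x => - weakDerivL2 1 (P t - P' t) x - (b (u x t) - b (u' x t)) := by
      filter_upwards [e₂ t ht', e₂' t ht', Lp.coeFn_sub
        (derivWithin (fun s => weakDerivL2 0 (U s)) (Icc 0 T) t)
        (derivWithin (fun s => weakDerivL2 0 (U' s)) (Icc 0 T) t),
        Lp.coeFn_sub (weakDerivL2 1 (P t)) (weakDerivL2 1 (P' t))] with x h1 h2 h3 h4
      rw [hWd, h3, weakDerivL2_sub, h4, Pi.sub_apply, Pi.sub_apply]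
      linarith
    have hk : ∀ x, 0 ≤ (b (u x t) - b (u' x t)) * (u x t - u' x t) := fun x => by
      rcases le_total (u x t) (u' x t) with h | h
      · exact mul_nonneg_of_nonpos_of_nonpos (sub_nonpos.2 (hmono h)) (sub_nonpos.2 h)
      · exact mul_nonneg (sub_nonneg.2 (hmono h)) (sub_nonneg.2 h)
    have hle : inner ℝ (Q t) Qd + inner ℝ (W t) Wd ≤ 0 :=
      SobolevSpace.energy_rate_nonpos ((hP t ht').1.sub (hP' t ht').1)
        ((hU t ht').1.sub (hU' t ht').1) (P := P t - P' t) (U := U t - U' t)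
        (hQ t ht') (hW t ht') (by simp [(bc t ht').1, (bc' t ht').1])
        (by simp [(bc t ht').2, (bc' t ht').2]) aQ aW hk
    linarith
  have anti : AntitoneOn E (Icc 0 T) := by
    apply antitoneOn_of_deriv_nonpos (convex_Icc 0 T) cE
    · rw [interior_Icc]
      intro t ht
      obtain ⟨e, _, he⟩ := hE t ht
      exact he.differentiableAt.differentiableWithinAt
    · rw [interior_Icc]
      intro t ht
      obtain ⟨e, he0, he⟩ := hE t ht
      rwa [he.deriv]
  have h0 : (0 : ℝ) ∈ Icc 0 T := ⟨le_rfl, hT.le⟩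
  have z : ∀ {X : L2Interval 0 1}, X =ᵐ[volume.restrict (Ioo (0 : ℝ) 1)] (fun _ => 0) → X = 0 :=
    fun {X} hX => Lp.ext (hX.trans (Lp.coeFn_zero _ _ _).symm)
  have E0 : E 0 = 0 := by
    have q0 : Q 0 = 0 := by
      refine z ((hQ 0 h0).trans ?_)
      filter_upwards [ae_restrict_mem measurableSet_Ioo] with x hx
      rw [(ic x (Ioo_subset_Icc_self hx)).1, (ic' x (Ioo_subset_Icc_self hx)).1, sub_self]
    have w0 : W 0 = 0 := by
      refine z ((hW 0 h0).trans ?_)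
      filter_upwards [ae_restrict_mem measurableSet_Ioo] with x hx
      rw [(ic x (Ioo_subset_Icc_self hx)).2, (ic' x (Ioo_subset_Icc_self hx)).2, sub_self]
    simp [E, q0, w0]
  have Et : E t ≤ 0 := (anti h0 ht ht.1).trans_eq E0
  have sq : ∀ {r r' : ℝ}, r ^ 2 + r' ^ 2 ≤ 0 → r = 0 ∧ r' = 0 := fun {r r'} h => by
    constructor <;> nlinarith [sq_nonneg r, sq_nonneg r']
  have q0 : Q t = 0 := norm_eq_zero.1 (sq Et).1
  have w0 : W t = 0 := norm_eq_zero.1 (sq Et).2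
  -- Equality in L² becomes equality at every point of the closed interval. The endpoints matter, as
  -- the pressure drop is read off there.
  have fin : ∀ {f f' : ℝ → ℝ}, ContinuousOn f (Icc 0 1) → ContinuousOn f' (Icc 0 1) →
      (fun x => f x - f' x) =ᵐ[volume.restrict (Ioo (0 : ℝ) 1)] (fun _ => 0) → f x = f' x := by
    intro f f' hf hf' hff
    rw [Measure.restrict_congr_set Ioo_ae_eq_Icc] at hff
    have := Measure.eqOn_of_ae_eq hff (hf.sub hf') continuousOn_const
      (by rw [interior_Icc, closure_Ioo zero_ne_one]) hx
    exact sub_eq_zero.1 this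
  have q0' := hQ t ht
  have w0' := hW t ht
  rw [q0] at q0'
  rw [w0] at w0'
  exact ⟨fin (hP t ht).1 (hP' t ht).1 (q0'.symm.trans (Lp.coeFn_zero _ _ _)),
    fin (hU t ht).1 (hU' t ht).1 (w0'.symm.trans (Lp.coeFn_zero _ _ _))⟩

/-! ### From pointwise derivatives to curves in Sobolev spaces -/

theorem ContinuousOn.memLp_Ioo {α β : ℝ} {f : ℝ → ℝ} (hf : ContinuousOn f (Icc α β)) :
    MemLp f 2 (volume.restrict (Ioo α β)) := by
  obtain ⟨C, hC⟩ := isCompact_Icc.exists_bound_of_continuousOn hf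
  refine MemLp.of_bound ((hf.mono Ioo_subset_Icc_self).aestronglyMeasurable measurableSet_Ioo) C ?_
  filter_upwards [ae_restrict_mem measurableSet_Ioo] with x hx
  exact hC x (Ioo_subset_Icc_self hx)

theorem L2Interval.exists_norm_le (α β : ℝ) : ∃ K, 0 < K ∧ ∀ (f : L2Interval α β) (C : ℝ), 0 ≤ C →
    (∀ᵐ x ∂(volume.restrict (Ioo α β)), |f x| ≤ C) → ‖f‖ ≤ K * C := by
  -- The summand 1 keeps K positive even for an empty interval.
  refine ⟨(measureUnivNNReal (volume.restrict (Ioo α β)) : ℝ) ^ (2 : ENNReal).toReal⁻¹ + 1,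
    by positivity, fun f C hC hf => ?_⟩
  refine (Lp.norm_le_of_ae_bound hC hf).trans ?_
  gcongr
  simp

theorem L2Interval.tendsto_of_uniform {α β : ℝ} {ι : Type*} {l : Filter ι}
    {f : ι → L2Interval α β} {g : L2Interval α β}
    (h : ∀ ε > 0, ∀ᶠ i in l, ∀ᵐ x ∂(volume.restrict (Ioo α β)), |f i x - g x| ≤ ε) :
    Tendsto f l (𝓝 g) := by
  obtain ⟨K, hK, hKb⟩ := L2Interval.exists_norm_le α β
  rw [tendsto_iff_norm_sub_tendsto_zero]
  refine Metric.tendsto_nhds.2 fun ε hε => ?_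
  filter_upwards [h (ε / (2 * K)) (by positivity)] with i hi
  have := hKb (f i - g) (ε / (2 * K)) (by positivity) (by
    filter_upwards [hi, Lp.coeFn_sub (f i) g] with x h1 h2
    rwa [h2])
  rw [Real.dist_eq, sub_zero, abs_of_nonneg (norm_nonneg _)]
  refine this.trans_lt ?_
  rw [show K * (ε / (2 * K)) = ε / 2 by field_simp]
  linarith

theorem eventually_forall_abs_sub_le {F : ℝ → ℝ → ℝ} (hF : Continuous (Function.uncurry F))
    (t₀ : ℝ) {ε : ℝ} (hε : 0 < ε) :
    ∀ᶠ t in 𝓝 t₀, ∀ x ∈ Icc (0 : ℝ) 1, |F x t - F x t₀| ≤ ε := by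
  refine isCompact_Icc.eventually_forall_of_forall_eventually fun y _ => ?_
  have h1 : Continuous fun z : ℝ × ℝ => |F z.2 z.1 - F z.2 t₀| :=
    ((hF.comp (continuous_snd.prodMk continuous_fst)).sub
      (hF.comp (continuous_snd.prodMk continuous_const))).abs
  have h2 : Tendsto (fun z : ℝ × ℝ => |F z.2 z.1 - F z.2 t₀|) (𝓝 (t₀, y)) (𝓝 0) := by
    have := h1.tendsto (t₀, y)
    simpa using this
  exact (h2.eventually_lt_const hε).mono fun z hz => hz.le

/-- The class in `L²(0,1)` of a time slice of a continuous function. -/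
noncomputable def sliceL2 (F : ℝ → ℝ → ℝ) (hF : Continuous (Function.uncurry F)) (t : ℝ) :
    L2Interval 0 1 :=
  MemLp.toLp (fun x => F x t)
    (hF.comp (continuous_id.prodMk continuous_const)).continuousOn.memLp_Ioo

theorem sliceL2_coeFn (F : ℝ → ℝ → ℝ) (hF : Continuous (Function.uncurry F)) (t : ℝ) :
    sliceL2 F hF t =ᵐ[volume.restrict (Ioo (0 : ℝ) 1)] fun x => F x t :=
  MemLp.coeFn_toLp _

theorem continuous_sliceL2 (F : ℝ → ℝ → ℝ) (hF : Continuous (Function.uncurry F)) :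
    Continuous (sliceL2 F hF) := by
  refine continuous_iff_continuousAt.2 fun t₀ => L2Interval.tendsto_of_uniform fun ε hε => ?_
  filter_upwards [eventually_forall_abs_sub_le hF t₀ hε] with t ht
  filter_upwards [sliceL2_coeFn F hF t, sliceL2_coeFn F hF t₀,
    ae_restrict_mem measurableSet_Ioo] with x h1 h2 h3
  rw [h1, h2]
  exact ht x (Ioo_subset_Icc_self h3)

/-- By the mean value inequality the remainder of F(x, ·) is controlled by the oscillation of F'(x,
·) near t₀. That oscillation is small uniformly in x ∈ [0,1] by compactness, so the remainder is
small in L². -/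
theorem hasDerivAt_sliceL2 {F F' : ℝ → ℝ → ℝ} (hF : Continuous (Function.uncurry F))
    (hF' : Continuous (Function.uncurry F'))
    (hd : ∀ x ∈ Icc (0 : ℝ) 1, ∀ t, HasDerivAt (fun s => F x s) (F' x t) t) (t₀ : ℝ) :
    HasDerivAt (sliceL2 F hF) (sliceL2 F' hF' t₀) t₀ := by
  obtain ⟨K, hK, hKb⟩ := L2Interval.exists_norm_le 0 1
  rw [hasDerivAt_iff_isLittleO, Asymptotics.isLittleO_iff]
  intro ε hε
  obtain ⟨δ, hδ, hball⟩ := Metric.eventually_nhds_iff_ball.1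
    (eventually_forall_abs_sub_le hF' t₀ (ε := ε / K) (by positivity))
  filter_upwards [Metric.ball_mem_nhds t₀ hδ] with t ht
  have main : ∀ x ∈ Icc (0 : ℝ) 1,
      |F x t - F x t₀ - (t - t₀) * F' x t₀| ≤ ε / K * |t - t₀| := by
    intro x hx
    have := (convex_ball t₀ δ).norm_image_sub_le_of_norm_hasDerivWithin_le
      (f := fun s => F x s - s * F' x t₀) (f' := fun s => F' x s - 1 * F' x t₀) (C := ε / K)
      (fun s _ => ((hd x hx s).sub ((hasDerivAt_id s).mul_const _)).hasDerivWithinAt)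
      (fun s hs => by simpa using hball s hs x hx) (Metric.mem_ball_self hδ) ht
    rw [Real.norm_eq_abs, Real.norm_eq_abs] at this
    convert! this using 2
    ring
  have := hKb (sliceL2 F hF t - sliceL2 F hF t₀ - (t - t₀) • sliceL2 F' hF' t₀)
    (ε / K * |t - t₀|) (by positivity) (by
      filter_upwards [sliceL2_coeFn F hF t, sliceL2_coeFn F hF t₀, sliceL2_coeFn F' hF' t₀,
        ae_restrict_mem measurableSet_Ioo,
        Lp.coeFn_sub (sliceL2 F hF t - sliceL2 F hF t₀) ((t - t₀) • sliceL2 F' hF' t₀),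
        Lp.coeFn_sub (sliceL2 F hF t) (sliceL2 F hF t₀),
        Lp.coeFn_smul (t - t₀) (sliceL2 F' hF' t₀)] with x h1 h2 h3 h4 h5 h6 h7
      rw [h5, Pi.sub_apply, h6, Pi.sub_apply, h7, Pi.smul_apply, h1, h2, h3, smul_eq_mul]
      exact main x (Ioo_subset_Icc_self h4))
  rw [show K * (ε / K * |t - t₀|) = ε * |t - t₀| by field_simp] at this
  exact this

theorem hasWeakDeriv_of_hasDerivAt {f g : ℝ → ℝ} (hf : Continuous f) (hg : Continuous g)
    (hd : ∀ x ∈ Ioo (0 : ℝ) 1, HasDerivAt f (g x) x) : HasWeakDeriv (Ioo 0 1) f g := by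
  have hsub : ∀ {α β : ℝ}, α ∈ Ioo (0 : ℝ) 1 → β ∈ Ioo (0 : ℝ) 1 → uIcc α β ⊆ Ioo 0 1 :=
    fun hα hβ => ordConnected_Ioo.uIcc_subset hα hβ
  refine HasWeakDeriv.of_absolutelyContinuous isOpen_Ioo ordConnected_Ioo
    (hf.locallyIntegrable.locallyIntegrableOn _) (hg.locallyIntegrable.locallyIntegrableOn _)
    (fun α hα β hβ => ?_) (fun α hα β hβ => Eventually.of_forall fun x hx =>
      (hd x (hsub hα hβ hx)).deriv)
  obtain ⟨C, hC⟩ := isCompact_uIcc.exists_bound_of_continuousOn (hg.continuousOn (s := uIcc α β))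
  exact ((convex_uIcc α β).lipschitzOnWith_of_nnnorm_hasDerivWithin_le (C := C.toNNReal)
    (fun x hx => (hd x (hsub hα hβ hx)).hasDerivWithinAt)
    (fun x hx => by
      rw [← NNReal.coe_le_coe, coe_nnnorm]
      exact (hC x hx).trans (Real.le_coe_toNNReal C))).absolutelyContinuousOnInterval

theorem exists_sobolevCurve {f ft fx : ℝ → ℝ → ℝ} (hf : Continuous (Function.uncurry f))
    (hft : Continuous (Function.uncurry ft)) (hfx : Continuous (Function.uncurry fx))
    (dt : ∀ x ∈ Icc (0 : ℝ) 1, ∀ t, HasDerivAt (fun s => f x s) (ft x t) t)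
    (dx : ∀ x ∈ Ioo (0 : ℝ) 1, ∀ t, HasDerivAt (fun y => f y t) (fx x t) x) :
    ∃ (P : ℝ → SobolevSpace 1 0 1), Continuous P ∧
      (∀ t, weakDerivL2 0 (P t) =ᵐ[volume.restrict (Ioo (0 : ℝ) 1)] fun x => f x t) ∧
      (∀ t, weakDerivL2 1 (P t) =ᵐ[volume.restrict (Ioo (0 : ℝ) 1)] fun x => fx x t) ∧
      ContDiff ℝ 1 (fun t => weakDerivL2 0 (P t)) ∧
      ∀ t, (deriv (fun t => weakDerivL2 0 (P t)) t : L2Interval 0 1)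
        =ᵐ[volume.restrict (Ioo (0 : ℝ) 1)] fun x => ft x t := by
  have hslice : ∀ {F : ℝ → ℝ → ℝ}, Continuous (Function.uncurry F) → ∀ t,
      Continuous fun x => F x t := fun h t => h.comp (continuous_id.prodMk continuous_const)
  let P : ℝ → SobolevSpace 1 0 1 := fun t =>
    ⟨WithLp.toLp 2 ![sliceL2 f hf t, sliceL2 fx hfx t], by
      intro j
      fin_cases j
      exact (hasWeakDeriv_of_hasDerivAt (hslice hf t) (hslice hfx t) fun x hx => dx x hx t).congr
        (sliceL2_coeFn f hf t).symm (sliceL2_coeFn fx hfx t).symm⟩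
  have hP : Continuous P := by
    refine Continuous.subtype_mk ((PiLp.continuous_toLp 2 _).comp (continuous_pi fun j => ?_)) _
    fin_cases j
    · exact continuous_sliceL2 f hf
    · exact continuous_sliceL2 fx hfx
  have hd : ∀ t, HasDerivAt (fun t => weakDerivL2 0 (P t)) (sliceL2 ft hft t) t :=
    fun t => hasDerivAt_sliceL2 hf hft dt t
  have hd' : deriv (fun t => weakDerivL2 0 (P t)) = sliceL2 ft hft := funext fun t => (hd t).deriv
  refine ⟨P, hP, sliceL2_coeFn f hf, sliceL2_coeFn fx hfx,
    contDiff_one_iff_deriv.2 ⟨fun t => (hd t).differentiableAt, ?_⟩, fun t => ?_⟩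
  · rw [hd']; exact continuous_sliceL2 ft hft
  · rw [hd']; exact sliceL2_coeFn ft hft t

/-- Space derivatives are required only in the open interval, because the Duhamel integral is
differentiated in x only away from the jumps of the square wave. Time derivatives exist for all real
t, so the one-sided derivatives at 0 and T are ordinary ones. -/
theorem isClassicalSolution_of_hasDerivAt {T c : ℝ} {g₀ g₁ b : ℝ → ℝ}
    {p pt px u ut ux : ℝ → ℝ → ℝ} (hT : 0 < T)
    (hp : Continuous (Function.uncurry p)) (hpt : Continuous (Function.uncurry pt))
    (hpx : Continuous (Function.uncurry px)) (hu : Continuous (Function.uncurry u))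
    (hut : Continuous (Function.uncurry ut)) (hux : Continuous (Function.uncurry ux))
    (dpt : ∀ x ∈ Icc (0 : ℝ) 1, ∀ t, HasDerivAt (fun s => p x s) (pt x t) t)
    (dpx : ∀ x ∈ Ioo (0 : ℝ) 1, ∀ t, HasDerivAt (fun y => p y t) (px x t) x)
    (dut : ∀ x ∈ Icc (0 : ℝ) 1, ∀ t, HasDerivAt (fun s => u x s) (ut x t) t)
    (dux : ∀ x ∈ Ioo (0 : ℝ) 1, ∀ t, HasDerivAt (fun y => u y t) (ux x t) x)
    (e₁ : ∀ t ∈ Icc 0 T, ∀ x ∈ Ioo (0 : ℝ) 1, pt x t + ux x t = 0)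
    (e₂ : ∀ t ∈ Icc 0 T, ∀ x ∈ Ioo (0 : ℝ) 1, ut x t + px x t + b (u x t) = 0)
    (bc : ∀ t ∈ Icc 0 T, u 0 t = g₀ t ∧ u 1 t = g₁ t)
    (ic : ∀ x ∈ Icc (0 : ℝ) 1, p x 0 = c ∧ u x 0 = 0) :
    IsClassicalSolution T c g₀ g₁ b p u := by
  have hslice : ∀ {F : ℝ → ℝ → ℝ}, Continuous (Function.uncurry F) → ∀ t,
      Continuous fun x => F x t := fun h t => h.comp (continuous_id.prodMk continuous_const)
  obtain ⟨P, cP, P0, P1, dP, tP⟩ := exists_sobolevCurve hp hpt hpx dpt dpx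
  obtain ⟨U, cU, U0, U1, dU, tU⟩ := exists_sobolevCurve hu hut hux dut dux
  have hder : ∀ {X : ℝ → L2Interval 0 1}, ContDiff ℝ 1 X → ∀ t ∈ Icc 0 T,
      derivWithin X (Icc 0 T) t = deriv X t := fun {X} hX t ht =>
    (hX.differentiable one_ne_zero t).derivWithin (uniqueDiffOn_Icc hT t ht)
  refine ⟨P, U, fun t _ => ⟨(hslice hp t).continuousOn, P0 t⟩,
    fun t _ => ⟨(hslice hu t).continuousOn, U0 t⟩, cP.continuousOn, cU.continuousOn,
    dP.contDiffOn, dU.contDiffOn, fun t ht => ?_, fun t ht => ?_, bc, ic⟩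
  · rw [hder dP t ht]
    filter_upwards [tP t, U1 t, ae_restrict_mem measurableSet_Ioo] with x h1 h2 h3
    rw [h1, h2]
    exact e₁ t ht x h3
  · rw [hder dU t ht]
    filter_upwards [tU t, P1 t, ae_restrict_mem measurableSet_Ioo] with x h1 h2 h3
    rw [h1, h2]
    exact e₂ t ht x h3

/-! ### Duhamel integral for the reflected source -/

/-- The even `2`-periodic extension of the identity of `[0,1]`. -/
noncomputable def foldUnit (y : ℝ) : ℝ := Real.arccos (Real.cos (Real.pi * y)) / Real.pi

/-- The odd `2`-periodic extension of the constant `1` on `(0,1)`. -/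
noncomputable def squareWave (y : ℝ) : ℝ := Real.sign (Real.sin (Real.pi * y))

theorem continuous_foldUnit : Continuous foldUnit := by
  unfold foldUnit
  exact (Real.continuous_arccos.comp (by fun_prop)).div_const _

theorem foldUnit_mem (y : ℝ) : foldUnit y ∈ Icc (0 : ℝ) 1 :=
  ⟨div_nonneg (Real.arccos_nonneg _) Real.pi_pos.le,
    (div_le_one Real.pi_pos).2 (Real.arccos_le_pi _)⟩

theorem foldUnit_of_mem {y : ℝ} (hy : y ∈ Icc (0 : ℝ) 1) : foldUnit y = y := by
  unfold foldUnit
  rw [Real.arccos_cos (mul_nonneg Real.pi_pos.le hy.1)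
    (mul_le_of_le_one_right Real.pi_pos.le hy.2), mul_div_cancel_left₀ _ Real.pi_ne_zero]

theorem foldUnit_neg (y : ℝ) : foldUnit (-y) = foldUnit y := by
  unfold foldUnit
  rw [mul_neg, Real.cos_neg]

theorem foldUnit_add_two (y : ℝ) : foldUnit (y + 2) = foldUnit y := by
  unfold foldUnit
  rw [show Real.pi * (y + 2) = Real.pi * y + 2 * Real.pi by ring, Real.cos_add_two_pi]

theorem squareWave_neg (y : ℝ) : squareWave (-y) = -squareWave y := by
  unfold squareWave
  rw [mul_neg, Real.sin_neg, Real.sign_neg]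

theorem squareWave_add_two (y : ℝ) : squareWave (y + 2) = squareWave y := by
  unfold squareWave
  rw [show Real.pi * (y + 2) = Real.pi * y + 2 * Real.pi by ring, Real.sin_add_two_pi]

theorem sin_pi_mul_pos {y : ℝ} (hy : y ∈ Ioo (0 : ℝ) 1) : 0 < Real.sin (Real.pi * y) :=
  Real.sin_pos_of_pos_of_lt_pi (mul_pos Real.pi_pos hy.1)
    (mul_lt_of_lt_one_right Real.pi_pos hy.2)

theorem squareWave_of_mem {y : ℝ} (hy : y ∈ Ioo (0 : ℝ) 1) : squareWave y = 1 :=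
  Real.sign_of_pos (sin_pi_mul_pos hy)

theorem abs_squareWave_le (y : ℝ) : |squareWave y| ≤ 1 := by
  unfold squareWave
  rcases Real.sign_apply_eq (Real.sin (Real.pi * y)) with h | h | h <;> rw [h] <;> norm_num

theorem measurable_squareWave : Measurable squareWave := by
  have h : squareWave = fun y => if Real.sin (Real.pi * y) < 0 then -1 else
      if 0 < Real.sin (Real.pi * y) then 1 else 0 := by
    ext y; rfl
  rw [h]
  have hc : Continuous fun y => Real.sin (Real.pi * y) := by fun_prop
  exact Measurable.ite (measurableSet_lt hc.measurable measurable_const) measurable_const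
    (Measurable.ite (measurableSet_lt measurable_const hc.measurable) measurable_const
      measurable_const)

theorem continuousAt_squareWave {y : ℝ} (hy : Real.sin (Real.pi * y) ≠ 0) :
    ContinuousAt squareWave y := by
  have hc : Continuous fun y => Real.sin (Real.pi * y) := by fun_prop
  rcases lt_or_gt_of_ne hy with h | h
  · have : squareWave =ᶠ[𝓝 y] fun _ => -1 := by
      filter_upwards [hc.continuousAt.eventually_lt_const h] with z hz
      exact Real.sign_of_neg hz
    exact this.continuousAt
  · have : squareWave =ᶠ[𝓝 y] fun _ => 1 := by
      filter_upwards [hc.continuousAt.eventually_const_lt h] with z hz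
      exact Real.sign_of_pos hz
    exact this.continuousAt

theorem ae_sin_pi_sub_ne_zero (x : ℝ) : ∀ᵐ τ : ℝ, Real.sin (Real.pi * (x - τ)) ≠ 0 := by
  have hsub : {τ : ℝ | ¬ Real.sin (Real.pi * (x - τ)) ≠ 0} ⊆ range fun n : ℤ => x - n := by
    intro τ hτ
    simp only [ne_eq, not_not, mem_ofPred_eq] at hτ
    obtain ⟨n, hn⟩ := Real.sin_eq_zero_iff.1 hτ
    refine ⟨n, ?_⟩
    have : (n : ℝ) = x - τ := by
      apply mul_left_cancel₀ Real.pi_ne_zero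
      rw [← hn]; ring
    simp only [this]; ring
  exact (countable_range _).mono hsub |>.measure_zero _

/-- Duhamel integral along characteristics of the odd `2`-periodic extension of `k`: the solution of
`∂ₜ r + ∂ₓ r = k` on `(0,1)`, `∂ₜ r + ∂ₓ r = -k(-x)` on `(-1,0)` with vanishing initial value. -/
noncomputable def duhamel (k : ℝ → ℝ → ℝ) (x t : ℝ) : ℝ :=
  ∫ s in (0 : ℝ)..t, squareWave (x - t + s) * k (foldUnit (x - t + s)) s

theorem intervalIntegrable_squareWave_mul {φ h : ℝ → ℝ} (hφ : Continuous φ) (hh : Continuous h)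
    (α β : ℝ) : IntervalIntegrable (fun s => squareWave (φ s) * h s) volume α β := by
  refine (hh.intervalIntegrable α β).mono_fun
    ((measurable_squareWave.comp hφ.measurable).mul hh.measurable).aestronglyMeasurable ?_
  refine Eventually.of_forall fun s => ?_
  simp only [norm_mul, Real.norm_eq_abs]
  exact mul_le_of_le_one_left (abs_nonneg _) (abs_squareWave_le _)

theorem continuous_comp_foldUnit {k : ℝ → ℝ → ℝ} (hk : Continuous (Function.uncurry k))
    {α : Type*} [TopologicalSpace α] {φ ψ : α → ℝ} (hφ : Continuous φ) (hψ : Continuous ψ) :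
    Continuous fun s => k (foldUnit (φ s)) (ψ s) :=
  hk.comp ((continuous_foldUnit.comp hφ).prodMk hψ)

theorem duhamel_integrable {k : ℝ → ℝ → ℝ} (hk : Continuous (Function.uncurry k)) (z α β : ℝ) :
    IntervalIntegrable (fun s => squareWave (z + s) * k (foldUnit (z + s)) s) volume α β :=
  intervalIntegrable_squareWave_mul (by fun_prop)
    (continuous_comp_foldUnit hk (by fun_prop) continuous_id) α β

theorem duhamel_sub {k k' : ℝ → ℝ → ℝ} (hk : Continuous (Function.uncurry k))
    (hk' : Continuous (Function.uncurry k')) (x t : ℝ) :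
    duhamel k x t - duhamel k' x t = duhamel (fun y s => k y s - k' y s) x t := by
  unfold duhamel
  rw [← intervalIntegral.integral_sub (duhamel_integrable hk _ _ _) (duhamel_integrable hk' _ _ _)]
  congr 1; ext s; ring

theorem duhamel_add_two (k : ℝ → ℝ → ℝ) (x t : ℝ) : duhamel k (x + 2) t = duhamel k x t := by
  unfold duhamel
  congr 1; ext s
  rw [show x + 2 - t + s = x - t + s + 2 by ring, squareWave_add_two, foldUnit_add_two]

/-- The gain 1/μ in the exponentially weighted norm drives the contraction for existence as well as
the stability estimate. -/
theorem abs_duhamel_le {k : ℝ → ℝ → ℝ} {C μ t : ℝ} (hC : 0 ≤ C) (hμ : 0 < μ) (ht : 0 ≤ t)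
    (h : ∀ y ∈ Icc (0 : ℝ) 1, ∀ s ∈ Icc 0 t, |k y s| ≤ C * Real.exp (μ * s)) (x : ℝ) :
    |duhamel k x t| ≤ C / μ * Real.exp (μ * t) := by
  have h1 : |duhamel k x t| ≤ ∫ s in (0 : ℝ)..t, C * Real.exp (μ * s) := by
    have hc : Continuous fun s => C * Real.exp (μ * s) := by fun_prop
    unfold duhamel
    rw [← Real.norm_eq_abs]
    refine intervalIntegral.norm_integral_le_of_norm_le ht ?_
      (hc.intervalIntegrable (μ := volume) _ _)
    refine Eventually.of_forall fun s hs => ?_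
    rw [norm_mul, Real.norm_eq_abs, Real.norm_eq_abs]
    exact (mul_le_of_le_one_left (abs_nonneg _) (abs_squareWave_le _)).trans
      (h _ (foldUnit_mem _) s ⟨hs.1.le, hs.2⟩)
  refine h1.trans ?_
  rw [intervalIntegral.integral_const_mul, intervalIntegral.integral_comp_mul_left _ hμ.ne']
  simp only [integral_exp, mul_zero, Real.exp_zero, smul_eq_mul]
  rw [div_eq_mul_inv, mul_assoc]
  gcongr
  linarith

/-- After τ = t - s the discontinuous factor no longer depends on t, and the vanishing of k at
nonpositive times allows an upper limit N independent of t. A time derivative then falls on k alone.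
-/
theorem duhamel_eq_integral_sub {k : ℝ → ℝ → ℝ} (hk : Continuous (Function.uncurry k))
    (h0 : ∀ y, ∀ s ≤ 0, k y s = 0) {x t N : ℝ} (htN : t ≤ N) :
    duhamel k x t =
      ∫ τ in (0 : ℝ)..N, squareWave (x - τ) * k (foldUnit (x - τ)) (t - τ) := by
  have hi : ∀ α β, IntervalIntegrable
      (fun τ => squareWave (x - τ) * k (foldUnit (x - τ)) (t - τ)) volume α β :=
    intervalIntegrable_squareWave_mul (by fun_prop)
      (continuous_comp_foldUnit hk (by fun_prop) (by fun_prop))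
  have e : duhamel k x t =
      ∫ τ in (0 : ℝ)..t, squareWave (x - τ) * k (foldUnit (x - τ)) (t - τ) := by
    have := intervalIntegral.integral_comp_sub_left (a := 0) (b := t)
      (fun τ => squareWave (x - τ) * k (foldUnit (x - τ)) (t - τ)) t
    simp only [sub_self, sub_zero] at this
    rw [← this]
    unfold duhamel
    congr 1; ext s
    rw [show x - (t - s) = x - t + s by ring, sub_sub_cancel]
  have z : ∫ τ in t..N, squareWave (x - τ) * k (foldUnit (x - τ)) (t - τ) = 0 := by
    rw [intervalIntegral.integral_congr (g := fun _ => 0)]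
    · simp
    · intro τ hτ
      rw [uIcc_of_le htN] at hτ
      simp only [h0 _ (t - τ) (by linarith [hτ.1]), mul_zero]
  rw [e, ← intervalIntegral.integral_add_adjacent_intervals (hi 0 t) (hi t N), z, add_zero]

theorem exists_bound_of_vanishing {k : ℝ → ℝ → ℝ} (hk : Continuous (Function.uncurry k))
    (h0 : ∀ y, ∀ s ≤ 0, k y s = 0) (N : ℝ) :
    ∃ C, 0 ≤ C ∧ ∀ y ∈ Icc (0 : ℝ) 1, ∀ s ≤ N, |k y s| ≤ C := by
  obtain ⟨C, hC⟩ := ((isCompact_Icc (a := (0 : ℝ)) (b := 1)).prod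
    (isCompact_Icc (a := (0 : ℝ)) (b := N))).exists_bound_of_continuousOn hk.continuousOn
  refine ⟨max C 0, le_max_right _ _, fun y hy s hs => ?_⟩
  rcases le_total s 0 with h | h
  · rw [h0 y s h, abs_zero]; exact le_max_right _ _
  · exact (hC (y, s) ⟨hy, h, hs⟩).trans (le_max_left _ _)

/-- The integrand is discontinuous at (x₀, t₀) only for τ in the null set x₀ - ℤ, so dominated
convergence applies. -/
theorem continuous_duhamel {k : ℝ → ℝ → ℝ} (hk : Continuous (Function.uncurry k))
    (h0 : ∀ y, ∀ s ≤ 0, k y s = 0) : Continuous (Function.uncurry (duhamel k)) := by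
  refine continuous_iff_continuousAt.2 fun ⟨x₀, t₀⟩ => ?_
  -- One upper limit that serves all times near t₀.
  set N := |t₀| + 1 with hN
  have hev : ∀ᶠ z : ℝ × ℝ in 𝓝 (x₀, t₀), z.2 < N :=
    (continuous_snd.tendsto (x₀, t₀)).eventually_lt_const (by
      show t₀ < N
      linarith [le_abs_self t₀])
  have hN0 : 0 ≤ N := by positivity
  obtain ⟨C, hC0, hC⟩ := exists_bound_of_vanishing hk h0 N
  have hcont : ContinuousAt (fun z : ℝ × ℝ => ∫ τ in (0 : ℝ)..N,
      squareWave (z.1 - τ) * k (foldUnit (z.1 - τ)) (z.2 - τ)) (x₀, t₀) := by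
    refine intervalIntegral.continuousAt_of_dominated_interval (bound := fun _ => C) ?_ ?_
      (by simp) ?_
    · exact Eventually.of_forall fun z => (intervalIntegrable_iff.1
        (intervalIntegrable_squareWave_mul (φ := fun τ => z.1 - τ) (by fun_prop)
        (continuous_comp_foldUnit hk (φ := fun τ => z.1 - τ) (ψ := fun τ => z.2 - τ) (by fun_prop)
          (by fun_prop)) 0 N)).aestronglyMeasurable
    · filter_upwards [hev] with z hz
      refine Eventually.of_forall fun τ hτ => ?_
      rw [uIoc_of_le hN0] at hτ
      rw [norm_mul, Real.norm_eq_abs, Real.norm_eq_abs]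
      exact (mul_le_of_le_one_left (abs_nonneg _) (abs_squareWave_le _)).trans
        (hC _ (foldUnit_mem _) _ (by linarith [hτ.1]))
    · filter_upwards [ae_sin_pi_sub_ne_zero x₀] with τ hτ _
      refine ContinuousAt.mul ?_
        (continuous_comp_foldUnit hk (by fun_prop) (by fun_prop)).continuousAt
      exact ContinuousAt.comp (f := fun z : ℝ × ℝ => z.1 - τ) (x := (x₀, t₀))
        (continuousAt_squareWave hτ) (by fun_prop)
  refine hcont.congr ?_
  filter_upwards [hev] with z hz
  exact (duhamel_eq_integral_sub hk h0 hz.le).symm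

theorem hasDerivAt_duhamel_time {k k' : ℝ → ℝ → ℝ} (hk : Continuous (Function.uncurry k))
    (hk' : Continuous (Function.uncurry k')) (h0 : ∀ y, ∀ s ≤ 0, k y s = 0)
    (h0' : ∀ y, ∀ s ≤ 0, k' y s = 0)
    (hd : ∀ y ∈ Icc (0 : ℝ) 1, ∀ s, HasDerivAt (k y) (k' y s) s) (x t₀ : ℝ) :
    HasDerivAt (duhamel k x) (duhamel k' x t₀) t₀ := by
  set N := |t₀| + 1 with hN
  have ht₀ : t₀ < N := by linarith [le_abs_self t₀]
  have hN0 : 0 ≤ N := by positivity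
  obtain ⟨C, hC0, hC⟩ := exists_bound_of_vanishing hk' h0' N
  have hi : ∀ {k : ℝ → ℝ → ℝ}, Continuous (Function.uncurry k) → ∀ t, IntervalIntegrable
      (fun τ => squareWave (x - τ) * k (foldUnit (x - τ)) (t - τ)) volume 0 N := fun hk t =>
    intervalIntegrable_squareWave_mul (by fun_prop)
      (continuous_comp_foldUnit hk (by fun_prop) (by fun_prop)) 0 N
  have key := (intervalIntegral.hasDerivAt_integral_of_dominated_loc_of_deriv_le (μ := volume)
    (a := 0) (b := N) (s := Iio N) (x₀ := t₀) (bound := fun _ => C)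
    (F := fun t τ => squareWave (x - τ) * k (foldUnit (x - τ)) (t - τ))
    (F' := fun t τ => squareWave (x - τ) * k' (foldUnit (x - τ)) (t - τ))
    (Iio_mem_nhds ht₀)
    (Eventually.of_forall fun t => (intervalIntegrable_iff.1 (hi hk t)).aestronglyMeasurable)
    (hi hk t₀) (intervalIntegrable_iff.1 (hi hk' t₀)).aestronglyMeasurable
    (Eventually.of_forall fun τ hτ t ht => by
      rw [uIoc_of_le hN0] at hτ
      rw [norm_mul, Real.norm_eq_abs, Real.norm_eq_abs]
      exact (mul_le_of_le_one_left (abs_nonneg _) (abs_squareWave_le _)).trans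
        (hC _ (foldUnit_mem _) _ (by linarith [hτ.1, mem_Iio.1 ht])))
    (by simp)
    (Eventually.of_forall fun τ _ t _ =>
      ((hd _ (foldUnit_mem _) (t - τ)).comp_sub_const t τ).const_mul _)).2
  rw [duhamel_eq_integral_sub hk' h0' ht₀.le]
  refine key.congr_of_eventuallyEq ?_
  filter_upwards [Iio_mem_nhds ht₀] with t ht
  exact duhamel_eq_integral_sub hk h0 (le_of_lt ht)

/-- No differentiability of G in y is needed: the increment in the second variable is linear up to
o(|y - x|), uniformly for nearby first arguments, by joint continuity of G'. -/
theorem hasDerivAt_diagonal_increment {G G' : ℝ → ℝ → ℝ} (hG' : Continuous (Function.uncurry G'))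
    (hd : ∀ y s, HasDerivAt (G y) (G' y s) s) (x t : ℝ) :
    HasDerivAt (fun y => G y (t + (y - x)) - G y t) (G' x t) x := by
  rw [hasDerivAt_iff_isLittleO, Asymptotics.isLittleO_iff]
  intro ε hε
  obtain ⟨δ, hδ, hball⟩ := Metric.continuous_iff.1 hG' (x, t) ε hε
  filter_upwards [Metric.ball_mem_nhds x hδ] with y hy
  rw [Metric.mem_ball, Real.dist_eq] at hy
  have := (convex_ball t δ).norm_image_sub_le_of_norm_hasDerivWithin_le
    (f := fun s => G y s - s * G' x t) (f' := fun s => G' y s - 1 * G' x t) (C := ε)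
    (fun s _ => ((hd y s).sub ((hasDerivAt_id s).mul_const _)).hasDerivWithinAt)
    (fun s hs => by
      have h := hball (y, s) (by
        rw [Prod.dist_eq]
        exact max_lt (by rw [Real.dist_eq]; exact hy) hs)
      rw [Real.dist_eq] at h
      simpa using h.le) (Metric.mem_ball_self hδ)
    (y := t + (y - x)) (by simpa [Real.dist_eq] using hy)
  rw [add_sub_cancel_left] at this
  convert! this using 2
  simp only [smul_eq_mul, sub_self, add_zero]
  ring

/-- Along the characteristic through (x, t) the Duhamel integral is a plain primitive of its source.
Subtracting the time increment along the way leaves the x-derivative, so k is never differentiated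
in space. The condition on the sine keeps x away from the jumps. -/
theorem hasDerivAt_duhamel_space {k k' : ℝ → ℝ → ℝ} (hk : Continuous (Function.uncurry k))
    (hk' : Continuous (Function.uncurry k')) (h0 : ∀ y, ∀ s ≤ 0, k y s = 0)
    (h0' : ∀ y, ∀ s ≤ 0, k' y s = 0)
    (hd : ∀ y ∈ Icc (0 : ℝ) 1, ∀ s, HasDerivAt (k y) (k' y s) s) {x : ℝ} (t : ℝ)
    (hx : Real.sin (Real.pi * x) ≠ 0) :
    HasDerivAt (fun y => duhamel k y t)
      (squareWave x * k (foldUnit x) t - duhamel k' x t) x := by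
  have h1 := hasDerivAt_diagonal_increment (continuous_duhamel hk' h0')
    (hasDerivAt_duhamel_time hk hk' h0 h0' hd) x t
  set f : ℝ → ℝ := fun s => squareWave (x - t + s) * k (foldUnit (x - t + s)) s with hf
  have hft : f t = squareWave x * k (foldUnit x) t := by simp [hf]
  have hcont : ContinuousAt f t := by
    refine ContinuousAt.mul ?_
      (continuous_comp_foldUnit hk (by fun_prop) continuous_id).continuousAt
    exact ContinuousAt.comp (f := fun s => x - t + s) (x := t)
      (continuousAt_squareWave (by rwa [sub_add_cancel])) (by fun_prop)
  have hm : StronglyMeasurable f :=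
    ((measurable_squareWave.comp (by fun_prop)).mul (continuous_comp_foldUnit hk (by fun_prop)
      continuous_id).measurable).stronglyMeasurable
  have h2 := intervalIntegral.integral_hasDerivAt_right (duhamel_integrable hk (x - t) 0 t)
    (hm.stronglyMeasurableAtFilter) hcont
  -- The difference of position and time is constant on the characteristic, so only the upper limit
  -- of integration moves.
  have h3 : HasDerivAt (fun y => duhamel k y (t + (y - x))) (f t) x := by
    have h4 : HasDerivAt (fun y => t + (y - x)) 1 x :=
      ((hasDerivAt_id x).sub_const x).const_add t
    have h5 := HasDerivAt.comp (h₂ := fun u => ∫ s in (0 : ℝ)..u, f s) x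
      (by simpa using h2) h4
    rw [mul_one, ← hft] at h5
    refine h5.congr_of_eventuallyEq (Eventually.of_forall fun y => ?_)
    simp only [duhamel, Function.comp, hf]
    congr 1; ext s
    rw [show y - (t + (y - x)) + s = x - t + s by ring]
  rw [← hft]
  refine (h3.sub h1).congr_of_eventuallyEq (Eventually.of_forall fun y => ?_)
  simp

/-! ### An undamped wave carrying the boundary data -/

/-- Freezing g' outside [0,T] and integrating gives a C¹ extension with bounded derivative. It
vanishes for negative times because g(0) = g'(0) = 0. -/
theorem IsAdmissibleBoundaryData.exists_extension {T : ℝ} (hT : 0 < T) {g : ℝ → ℝ}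
    (hg : IsAdmissibleBoundaryData T g) :
    ∃ (γ γ' : ℝ → ℝ) (M : ℝ), Continuous γ' ∧ (∀ z, HasDerivAt γ (γ' z) z) ∧
      (∀ z ≤ 0, γ z = 0 ∧ γ' z = 0) ∧ (∀ t ∈ Icc 0 T, γ t = g t) ∧ ∀ z, |γ' z| ≤ M := by
  obtain ⟨hc, h0, h1⟩ := hg
  have hd : ContinuousOn (derivWithin g (Icc 0 T)) (Icc 0 T) :=
    hc.continuousOn_derivWithin (uniqueDiffOn_Icc hT) (by norm_num)
  have hmem : ∀ z, max 0 (min z T) ∈ Icc 0 T := fun z =>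
    ⟨le_max_left _ _, max_le hT.le (min_le_right _ _)⟩
  let γ' : ℝ → ℝ := fun z => derivWithin g (Icc 0 T) (max 0 (min z T))
  have cγ' : Continuous γ' := hd.comp_continuous (by fun_prop) hmem
  have zγ' : ∀ z ≤ 0, γ' z = 0 := fun z hz => by
    show derivWithin g (Icc 0 T) (max 0 (min z T)) = 0
    rw [max_eq_left ((min_le_left z T).trans hz), h1]
  obtain ⟨M, hM⟩ := isCompact_Icc.exists_bound_of_continuousOn hd
  refine ⟨fun z => ∫ s in (0 : ℝ)..z, γ' s, γ', M, cγ',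
    fun z => (cγ'.integral_hasStrictDerivAt 0 z).hasDerivAt, fun z hz => ⟨?_, zγ' z hz⟩,
    fun t ht => ?_, fun z => hM _ (hmem z)⟩
  · simp only
    rw [intervalIntegral.integral_congr (g := fun _ => 0)]
    · simp
    · intro s hs
      rw [uIcc_of_ge hz] at hs
      exact zγ' s hs.2
  · have := intervalIntegral.integral_eq_sub_of_hasDerivAt_of_le ht.1 (f := g) (f' := γ')
      (hc.continuousOn.mono (Icc_subset_Icc_right ht.2)) (fun x hx => by
        have hxT : x < T := hx.2.trans_le ht.2
        have hx' : max 0 (min x T) = x := by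
          rw [min_eq_left hxT.le, max_eq_right hx.1.le]
        show HasDerivAt g (derivWithin g (Icc 0 T) (max 0 (min x T))) x
        rw [hx']
        exact ((hc.differentiableOn (by norm_num) x ⟨hx.1.le, hxT.le⟩).hasDerivWithinAt).hasDerivAt
          (Icc_mem_nhds hx.1 hxT)) (cγ'.intervalIntegrable _ _)
    simp only
    rw [this, h0, sub_zero]

/-- A solution of the undamped wave system with the prescribed initial and boundary values. -/
structure IsBoundaryLift (T c : ℝ) (g₀ g₁ : ℝ → ℝ) (u ut p pt : ℝ → ℝ → ℝ) (M : ℝ) : Prop where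
  cont_u : Continuous (Function.uncurry u)
  cont_ut : Continuous (Function.uncurry ut)
  cont_p : Continuous (Function.uncurry p)
  cont_pt : Continuous (Function.uncurry pt)
  deriv_ut : ∀ x t, HasDerivAt (u x) (ut x t) t
  deriv_pt : ∀ x t, HasDerivAt (p x) (pt x t) t
  deriv_ux : ∀ x t, HasDerivAt (fun y => u y t) (-pt x t) x
  deriv_px : ∀ x t, HasDerivAt (fun y => p y t) (-ut x t) x
  boundary : ∀ t ∈ Icc 0 T, u 0 t = g₀ t ∧ u 1 t = g₁ t
  initial : ∀ x ∈ Icc (0 : ℝ) 1, u x 0 = 0 ∧ ut x 0 = 0 ∧ p x 0 = c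
  bound_nonneg : 0 ≤ M
  bound : ∀ x t, |ut x t| ≤ M

/-- The sum of the translates of `γ` by `0, 2, …, 2 (K - 1)`. -/
def reflectionSum (K : ℕ) (γ : ℝ → ℝ) (z : ℝ) : ℝ := ∑ k ∈ Finset.range K, γ (z - 2 * k)

/-- The sum telescopes. For γ vanishing at nonpositive arguments and z ≤ 2K the right side is γ(z),
so the reflected waves reproduce the prescribed boundary value. -/
theorem reflectionSum_sub (K : ℕ) (γ : ℝ → ℝ) (z : ℝ) :
    reflectionSum K γ z - reflectionSum K γ (z - 2) = γ z - γ (z - 2 * K) := by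
  unfold reflectionSum
  rw [← Finset.sum_sub_distrib]
  have := Finset.sum_range_sub' (fun k : ℕ => γ (z - 2 * k)) K
  simp only [Nat.cast_zero, mul_zero, sub_zero] at this
  rw [← this]
  refine Finset.sum_congr rfl fun k _ => ?_
  rw [show z - 2 - 2 * (k : ℝ) = z - 2 * ((k + 1 : ℕ) : ℝ) by push_cast; ring]

theorem hasDerivAt_reflectionSum (K : ℕ) {γ γ' : ℝ → ℝ} (h : ∀ z, HasDerivAt γ (γ' z) z) (z : ℝ) :
    HasDerivAt (reflectionSum K γ) (reflectionSum K γ' z) z := by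
  unfold reflectionSum
  exact HasDerivAt.fun_sum fun k _ => (h _).comp_sub_const z (2 * (k : ℝ))

theorem continuous_reflectionSum (K : ℕ) {γ : ℝ → ℝ} (h : Continuous γ) :
    Continuous (reflectionSum K γ) := by
  unfold reflectionSum
  fun_prop

theorem reflectionSum_eq_zero (K : ℕ) {γ : ℝ → ℝ} (h : ∀ z ≤ 0, γ z = 0) {z : ℝ} (hz : z ≤ 0) :
    reflectionSum K γ z = 0 :=
  Finset.sum_eq_zero fun k _ => h _ (by linarith [(Nat.cast_nonneg k : (0 : ℝ) ≤ k)])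

theorem abs_reflectionSum_le (K : ℕ) {γ : ℝ → ℝ} {M : ℝ} (h : ∀ z, |γ z| ≤ M) (z : ℝ) :
    |reflectionSum K γ z| ≤ K * M := by
  unfold reflectionSum
  refine (Finset.abs_sum_le_sum_abs _ _).trans ?_
  refine (Finset.sum_le_card_nsmul _ _ M fun k _ => h _).trans ?_
  simp

/-- d'Alembert's formula: A and B collect the waves sent out from x = 0 and x = 1 with their
reflections, which return after time 2. The velocity is the sum of right- and left-moving waves; the
pressure, up to c, is their difference. -/
theorem exists_boundaryLift {T : ℝ} (hT : 0 < T) (c : ℝ) {g₀ g₁ : ℝ → ℝ}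
    (hg₀ : IsAdmissibleBoundaryData T g₀) (hg₁ : IsAdmissibleBoundaryData T g₁) :
    ∃ u ut p pt M, IsBoundaryLift T c g₀ g₁ u ut p pt M := by
  obtain ⟨γ₀, γ₀', M₀, c₀, d₀, z₀, e₀, b₀⟩ := hg₀.exists_extension hT
  obtain ⟨γ₁, γ₁', M₁, c₁, d₁, z₁, e₁, b₁⟩ := hg₁.exists_extension hT
  -- With 2K ≥ T the telescoping remainder γ(t - 2K) vanishes on [0,T].
  obtain ⟨K, hK⟩ := exists_nat_ge T
  have cγ₀ : Continuous γ₀ := continuous_iff_continuousAt.2 fun z => (d₀ z).continuousAt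
  have cγ₁ : Continuous γ₁ := continuous_iff_continuousAt.2 fun z => (d₁ z).continuousAt
  set A := reflectionSum K γ₀ with hA
  set B := reflectionSum K γ₁ with hB
  set A' := reflectionSum K γ₀' with hA'
  set B' := reflectionSum K γ₁' with hB'
  have cA : Continuous A := continuous_reflectionSum K cγ₀
  have cB : Continuous B := continuous_reflectionSum K cγ₁
  have cA' : Continuous A' := continuous_reflectionSum K c₀
  have cB' : Continuous B' := continuous_reflectionSum K c₁
  have dA : ∀ z, HasDerivAt A (A' z) z := hasDerivAt_reflectionSum K d₀
  have dB : ∀ z, HasDerivAt B (B' z) z := hasDerivAt_reflectionSum K d₁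
  have zA : ∀ z ≤ 0, A z = 0 := fun z hz => reflectionSum_eq_zero K (fun z hz => (z₀ z hz).1) hz
  have zB : ∀ z ≤ 0, B z = 0 := fun z hz => reflectionSum_eq_zero K (fun z hz => (z₁ z hz).1) hz
  have zA' : ∀ z ≤ 0, A' z = 0 := fun z hz => reflectionSum_eq_zero K (fun z hz => (z₀ z hz).2) hz
  have zB' : ∀ z ≤ 0, B' z = 0 := fun z hz => reflectionSum_eq_zero K (fun z hz => (z₁ z hz).2) hz
  have bA : ∀ z, |A' z| ≤ K * M₀ := abs_reflectionSum_le K b₀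
  have bB : ∀ z, |B' z| ≤ K * M₁ := abs_reflectionSum_le K b₁
  have right : ∀ {G G' : ℝ → ℝ}, (∀ z, HasDerivAt G (G' z) z) → ∀ e x t : ℝ,
      HasDerivAt (fun y => G (t + y - e)) (G' (t + x - e)) x := fun {G G'} h e x t => by
    simpa [Function.comp_def] using
      (h (t + x - e)).comp x (((hasDerivAt_id x).const_add t).sub_const e)
  have left : ∀ {G G' : ℝ → ℝ}, (∀ z, HasDerivAt G (G' z) z) → ∀ e x t : ℝ,
      HasDerivAt (fun y => G (t - y - e)) (-G' (t - x - e)) x := fun {G G'} h e x t => by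
    simpa [Function.comp_def] using
      (h (t - x - e)).comp x (((hasDerivAt_id x).const_sub t).sub_const e)
  have time : ∀ {G G' : ℝ → ℝ}, (∀ z, HasDerivAt G (G' z) z) → ∀ e x t : ℝ,
      HasDerivAt (fun s => G (s + x - e)) (G' (t + x - e)) t := fun {G G'} h e x t => by
    simpa [Function.comp_def] using
      (h (t + x - e)).comp t (((hasDerivAt_id t).add_const x).sub_const e)
  have time' : ∀ {G G' : ℝ → ℝ}, (∀ z, HasDerivAt G (G' z) z) → ∀ e x t : ℝ,
      HasDerivAt (fun s => G (s - x - e)) (G' (t - x - e)) t := fun {G G'} h e x t => by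
    simpa [Function.comp_def] using
      (h (t - x - e)).comp t (((hasDerivAt_id t).sub_const x).sub_const e)
  -- The shift by 0 gives all four waves the form expected by the derivative rules `left`, `right`,
  -- `time` and `time'`.
  refine ⟨fun x t => A (t - x - 0) - A (t + x - 2) + B (t + x - 1) - B (t - x - 1),
    fun x t => A' (t - x - 0) - A' (t + x - 2) + B' (t + x - 1) - B' (t - x - 1),
    fun x t => c + A (t - x - 0) + A (t + x - 2) - B (t + x - 1) - B (t - x - 1),
    fun x t => A' (t - x - 0) + A' (t + x - 2) - B' (t + x - 1) - B' (t - x - 1),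
    2 * (K * M₀) + 2 * (K * M₁), ?_⟩
  refine ⟨?_, ?_, ?_, ?_, fun x t => ?_, fun x t => ?_, fun x t => ?_, fun x t => ?_,
    fun t ht => ?_, fun x hx => ?_, ?_, fun x t => ?_⟩
  · unfold Function.uncurry; fun_prop
  · unfold Function.uncurry; fun_prop
  · unfold Function.uncurry; fun_prop
  · unfold Function.uncurry; fun_prop
  · exact (((time' dA 0 x t).sub (time dA 2 x t)).add (time dB 1 x t)).sub (time' dB 1 x t)
  · exact ((((time' dA 0 x t).const_add c).add (time dA 2 x t)).sub (time dB 1 x t)).sub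
      (time' dB 1 x t)
  · convert! (((left dA 0 x t).sub (right dA 2 x t)).add (right dB 1 x t)).sub (left dB 1 x t)
      using 1
    ring
  · convert! ((((left dA 0 x t).const_add c).add (right dA 2 x t)).sub (right dB 1 x t)).sub
      (left dB 1 x t) using 1
    ring
  · have hA2 := reflectionSum_sub K γ₀ t
    have hB2 := reflectionSum_sub K γ₁ t
    rw [(z₀ (t - 2 * K) (by linarith [ht.1, ht.2])).1, e₀ t ht] at hA2
    rw [(z₁ (t - 2 * K) (by linarith [ht.1, ht.2])).1, e₁ t ht] at hB2
    simp only [sub_zero, add_zero]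
    rw [show t + 1 - 2 = t - 1 by ring, show t + 1 - 1 = t by ring, show t - 1 - 1 = t - 2 by ring]
    constructor <;> linarith
  · obtain ⟨hx0, hx1⟩ := hx
    rw [zA _ (by linarith), zA _ (by linarith), zB _ (by linarith), zB _ (by linarith),
      zA' _ (by linarith), zA' _ (by linarith), zB' _ (by linarith), zB' _ (by linarith)]
    simp
  · have h0 := (abs_nonneg _).trans (bA 0)
    have h1 := (abs_nonneg _).trans (bB 0)
    linarith
  · have h1 := abs_le.1 (bA (t - x - 0))
    have h2 := abs_le.1 (bA (t + x - 2))
    have h3 := abs_le.1 (bB (t + x - 1))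
    have h4 := abs_le.1 (bB (t - x - 1))
    rw [abs_le]
    constructor <;> linarith [h1.1, h1.2, h2.1, h2.2, h3.1, h3.2, h4.1, h4.2]

/-! ### The integral equation for the time derivative of the velocity -/

open scoped BoundedContinuousFunction

theorem Continuous.comp_uncurry {α : Type*} [TopologicalSpace α] {F : ℝ → ℝ → ℝ}
    (hF : Continuous (Function.uncurry F)) {φ ψ : α → ℝ} (hφ : Continuous φ) (hψ : Continuous ψ) :
    Continuous fun z => F (φ z) (ψ z) :=
  hF.comp (hφ.prodMk hψ)

/-- Odd part of the Duhamel integral, which vanishes at `x = 0` and `x = 1`. -/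
noncomputable def duhamelOdd (k : ℝ → ℝ → ℝ) (x t : ℝ) : ℝ :=
  (duhamel k x t - duhamel k (-x) t) / 2

/-- Even part of the Duhamel integral. -/
noncomputable def duhamelEven (k : ℝ → ℝ → ℝ) (x t : ℝ) : ℝ :=
  (duhamel k x t + duhamel k (-x) t) / 2

theorem duhamelOdd_sub {k k' : ℝ → ℝ → ℝ} (hk : Continuous (Function.uncurry k))
    (hk' : Continuous (Function.uncurry k')) (x t : ℝ) :
    duhamelOdd k x t - duhamelOdd k' x t = duhamelOdd (fun y s => k y s - k' y s) x t := by
  unfold duhamelOdd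
  rw [← duhamel_sub hk hk', ← duhamel_sub hk hk']
  ring

theorem duhamelEven_sub {k k' : ℝ → ℝ → ℝ} (hk : Continuous (Function.uncurry k))
    (hk' : Continuous (Function.uncurry k')) (x t : ℝ) :
    duhamelEven k x t - duhamelEven k' x t = duhamelEven (fun y s => k y s - k' y s) x t := by
  unfold duhamelEven
  rw [← duhamel_sub hk hk', ← duhamel_sub hk hk']
  ring

theorem abs_duhamelOdd_le {k : ℝ → ℝ → ℝ} {C μ t : ℝ} (hC : 0 ≤ C) (hμ : 0 < μ) (ht : 0 ≤ t)
    (h : ∀ y ∈ Icc (0 : ℝ) 1, ∀ s ∈ Icc 0 t, |k y s| ≤ C * Real.exp (μ * s)) (x : ℝ) :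
    |duhamelOdd k x t| ≤ C / μ * Real.exp (μ * t) := by
  have h1 := abs_le.1 (abs_duhamel_le hC hμ ht h x)
  have h2 := abs_le.1 (abs_duhamel_le hC hμ ht h (-x))
  rw [duhamelOdd, abs_le]
  constructor <;> linarith [h1.1, h1.2, h2.1, h2.2]

theorem abs_duhamelEven_le {k : ℝ → ℝ → ℝ} {C μ t : ℝ} (hC : 0 ≤ C) (hμ : 0 < μ) (ht : 0 ≤ t)
    (h : ∀ y ∈ Icc (0 : ℝ) 1, ∀ s ∈ Icc 0 t, |k y s| ≤ C * Real.exp (μ * s)) (x : ℝ) :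
    |duhamelEven k x t| ≤ C / μ * Real.exp (μ * t) := by
  have h1 := abs_le.1 (abs_duhamel_le hC hμ ht h x)
  have h2 := abs_le.1 (abs_duhamel_le hC hμ ht h (-x))
  rw [duhamelEven, abs_le]
  constructor <;> linarith [h1.1, h1.2, h2.1, h2.2]

theorem continuous_duhamelOdd {k : ℝ → ℝ → ℝ} (hk : Continuous (Function.uncurry k))
    (h0 : ∀ y, ∀ s ≤ 0, k y s = 0) : Continuous (Function.uncurry (duhamelOdd k)) := by
  have h := continuous_duhamel hk h0
  exact (h.sub (h.comp (continuous_fst.neg.prodMk continuous_snd))).div_const 2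

theorem continuous_duhamelEven {k : ℝ → ℝ → ℝ} (hk : Continuous (Function.uncurry k))
    (h0 : ∀ y, ∀ s ≤ 0, k y s = 0) : Continuous (Function.uncurry (duhamelEven k)) := by
  have h := continuous_duhamel hk h0
  exact (h.add (h.comp (continuous_fst.neg.prodMk continuous_snd))).div_const 2

theorem continuous_timePrimitive {V : ℝ → ℝ → ℝ} (hV : Continuous (Function.uncurry V)) :
    Continuous (Function.uncurry fun y s => ∫ r in (0 : ℝ)..s, V y r) := by
  have h : Continuous (Function.uncurry fun (z : ℝ × ℝ) r => V z.1 r) :=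
    hV.comp ((continuous_fst.comp continuous_fst).prodMk continuous_snd)
  exact intervalIntegral.continuous_parametric_intervalIntegral_of_continuous h continuous_snd

theorem timePrimitive_eq_zero {V : ℝ → ℝ → ℝ} (h0 : ∀ y, ∀ s ≤ 0, V y s = 0) (y : ℝ) {s : ℝ}
    (hs : s ≤ 0) : ∫ r in (0 : ℝ)..s, V y r = 0 := by
  rw [intervalIntegral.integral_congr (g := fun _ => 0)]
  · simp
  · intro r hr
    rw [uIcc_of_ge hs] at hr
    exact h0 y r hr.2

/-- The time derivative of `b(u)` when `b' = β` and `u(y,s) = ∫₀ˢ V(y,r) dr`. -/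
noncomputable def dampingRate (β : ℝ → ℝ) (V : ℝ → ℝ → ℝ) (y s : ℝ) : ℝ :=
  β (∫ r in (0 : ℝ)..s, V y r) * V y s

theorem continuous_dampingRate {β : ℝ → ℝ} (hβ : Continuous β) {V : ℝ → ℝ → ℝ}
    (hV : Continuous (Function.uncurry V)) :
    Continuous (Function.uncurry (dampingRate β V)) :=
  (hβ.comp (continuous_timePrimitive hV)).mul hV

theorem dampingRate_eq_zero (β : ℝ → ℝ) {V : ℝ → ℝ → ℝ} (h0 : ∀ y, ∀ s ≤ 0, V y s = 0) (y s : ℝ)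
    (hs : s ≤ 0) : dampingRate β V y s = 0 := by
  rw [dampingRate, h0 y s hs, mul_zero]

/-- Split β(v)V - β(v')V' into β(v)(V - V') and (β(v) - β(v'))V'. Since μ ≥ 1, taking time
primitives does not increase the weighted distance. -/
theorem abs_dampingRate_sub_le {β : ℝ → ℝ} {L Λ : ℝ} (hL : ∀ x, |β x| ≤ L) (hΛ0 : 0 ≤ Λ)
    (hΛ : ∀ x y, |β y - β x| ≤ Λ * |y - x|) {V V' : ℝ → ℝ → ℝ}
    (hV : Continuous (Function.uncurry V)) (hV' : Continuous (Function.uncurry V'))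
    {M d μ y s : ℝ} (hμ : 1 ≤ μ) (hd : 0 ≤ d) (hs : 0 ≤ s)
    (hM : |V' y s| ≤ M) (h : ∀ r ∈ Icc 0 s, |V y r - V' y r| ≤ d * Real.exp (μ * r)) :
    |dampingRate β V y s - dampingRate β V' y s| ≤ (L + Λ * M) * d * Real.exp (μ * s) := by
  have cV : Continuous (V y) := hV.comp (continuous_const.prodMk continuous_id)
  have cV' : Continuous (V' y) := hV'.comp (continuous_const.prodMk continuous_id)
  have hμ0 : 0 < μ := one_pos.trans_le hμ
  have hprim : |(∫ r in (0 : ℝ)..s, V y r) - ∫ r in (0 : ℝ)..s, V' y r| ≤ d * Real.exp (μ * s) := by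
    rw [← intervalIntegral.integral_sub (cV.intervalIntegrable _ _) (cV'.intervalIntegrable _ _),
      ← Real.norm_eq_abs]
    have hc : Continuous fun r => d * Real.exp (μ * r) := by fun_prop
    refine (intervalIntegral.norm_integral_le_of_norm_le hs
      (Eventually.of_forall fun r hr => h r ⟨hr.1.le, hr.2⟩)
      (hc.intervalIntegrable (μ := volume) _ _)).trans ?_
    rw [intervalIntegral.integral_const_mul, intervalIntegral.integral_comp_mul_left _ hμ0.ne']
    simp only [integral_exp, mul_zero, Real.exp_zero, smul_eq_mul]
    refine mul_le_mul_of_nonneg_left ?_ hd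
    have h1 : μ⁻¹ ≤ 1 := inv_le_one_of_one_le₀ hμ
    have h2 : 1 ≤ Real.exp (μ * s) := Real.one_le_exp (by positivity)
    nlinarith
  have hL0 : 0 ≤ L := (abs_nonneg _).trans (hL 0)
  have e : dampingRate β V y s - dampingRate β V' y s =
      β (∫ r in (0 : ℝ)..s, V y r) * (V y s - V' y s) +
      (β (∫ r in (0 : ℝ)..s, V y r) - β (∫ r in (0 : ℝ)..s, V' y r)) * V' y s := by
    unfold dampingRate; ring
  rw [e]
  refine (abs_add_le _ _).trans ?_
  rw [abs_mul, abs_mul]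
  have t1 : |β (∫ r in (0 : ℝ)..s, V y r)| * |V y s - V' y s| ≤ L * (d * Real.exp (μ * s)) :=
    mul_le_mul (hL _) (h s ⟨hs, le_rfl⟩) (abs_nonneg _) hL0
  have t2 : |β (∫ r in (0 : ℝ)..s, V y r) - β (∫ r in (0 : ℝ)..s, V' y r)| * |V' y s| ≤
      Λ * (d * Real.exp (μ * s)) * M :=
    mul_le_mul ((hΛ _ _).trans (mul_le_mul_of_nonneg_left hprim hΛ0)) hM (abs_nonneg _)
      (by positivity)
  linarith

/-- Projection onto `[0, T]`. -/
noncomputable def clampTo (T z : ℝ) : ℝ := max 0 (min z T)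

theorem continuous_clampTo (T : ℝ) : Continuous (clampTo T) := by
  unfold clampTo; fun_prop

theorem clampTo_mem {T : ℝ} (hT : 0 ≤ T) (z : ℝ) : clampTo T z ∈ Icc 0 T :=
  ⟨le_max_left _ _, max_le hT (min_le_right _ _)⟩

theorem clampTo_of_mem {T z : ℝ} (hz : z ∈ Icc 0 T) : clampTo T z = z := by
  rw [clampTo, min_eq_left hz.2, max_eq_right hz.1]

theorem clampTo_of_nonpos {T z : ℝ} (hz : z ≤ 0) : clampTo T z = 0 :=
  max_eq_left ((min_le_left z T).trans hz)

/-- The weight 2L is chosen so that the Duhamel term contributes at most half of the bound: L ·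
2M/(2L) = M, while the forcing r contributes the other M. The bound is thus preserved by the
fixed-point map. -/
theorem abs_sub_duhamelOdd_dampingRate_le {L M t : ℝ} (hL0 : 0 < L) (hM : 0 ≤ M) {β : ℝ → ℝ}
    (hL : ∀ x, |β x| ≤ L) {V : ℝ → ℝ → ℝ} {r : ℝ} (hr : |r| ≤ M) (ht : 0 ≤ t)
    (hV : ∀ y, ∀ s ∈ Icc 0 t, |V y s| ≤ 2 * M * Real.exp (2 * L * s)) (x : ℝ) :
    |r - duhamelOdd (dampingRate β V) x t| ≤ 2 * M * Real.exp (2 * L * t) := by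
  have h1 : |duhamelOdd (dampingRate β V) x t| ≤
      L * (2 * M) / (2 * L) * Real.exp (2 * L * t) := by
    refine abs_duhamelOdd_le (by positivity) (by positivity) ht (fun y _ s hs => ?_) _
    rw [dampingRate, abs_mul, mul_assoc]
    exact mul_le_mul (hL _) (hV y s hs) (abs_nonneg _) hL0.le
  have h2 : L * (2 * M) / (2 * L) = M := by field_simp
  rw [h2] at h1
  have h4 : 1 ≤ Real.exp (2 * L * t) := Real.one_le_exp (by positivity)
  have h5 : M ≤ M * Real.exp (2 * L * t) := le_mul_of_one_le_right hM h4
  refine (abs_sub _ _).trans ?_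
  linarith

theorem abs_duhamelOdd_dampingRate_sub_le {β : ℝ → ℝ} {L Λ M d μ t : ℝ} (hM : 0 ≤ M)
    (hL : ∀ x, |β x| ≤ L) (hΛ0 : 0 ≤ Λ) (hΛ : ∀ x y, |β y - β x| ≤ Λ * |y - x|)
    (hμ : μ = 2 * (L + Λ * M) + 1) (hd : 0 ≤ d) (ht : 0 ≤ t) (hβ : Continuous β)
    {V V' : ℝ → ℝ → ℝ} (hV : Continuous (Function.uncurry V))
    (hV' : Continuous (Function.uncurry V')) (hVM : ∀ y s, |V' y s| ≤ M)
    (h : ∀ y, ∀ r ∈ Icc 0 t, |V y r - V' y r| ≤ d * Real.exp (μ * r)) (x : ℝ) :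
    |duhamelOdd (dampingRate β V) x t - duhamelOdd (dampingRate β V') x t| ≤
      1 / 2 * d * Real.exp (μ * t) := by
  have hL0 : 0 ≤ L := (abs_nonneg _).trans (hL 0)
  have hμ1 : 1 ≤ μ := by rw [hμ]; nlinarith [mul_nonneg hΛ0 hM]
  have hμ0 : 0 < μ := one_pos.trans_le hμ1
  rw [duhamelOdd_sub (continuous_dampingRate hβ hV) (continuous_dampingRate hβ hV')]
  have key : |duhamelOdd (fun y s => dampingRate β V y s - dampingRate β V' y s) x t| ≤
      (L + Λ * M) * d / μ * Real.exp (μ * t) :=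
    abs_duhamelOdd_le (by positivity) hμ0 ht (fun y _ s hs =>
      abs_dampingRate_sub_le hL hΛ0 hΛ hV hV' hμ1 hd hs.1 (hVM y s)
        fun r hr => h y r ⟨hr.1, hr.2.trans hs.2⟩) _
  refine key.trans (mul_le_mul_of_nonneg_right ?_ (Real.exp_pos _).le)
  rw [div_le_iff₀ hμ0, hμ]
  nlinarith

/-- Makes the invariant set of the fixed-point map complete. -/
theorem isClosed_boundedContinuous_weighted (φ ψ : ℝ → ℝ) :
    IsClosed {w : ℝ × ℝ →ᵇ ℝ | (∀ x t, |φ t * w (x, t)| ≤ ψ t) ∧ ∀ x, ∀ t ≤ 0, w (x, t) = 0} := by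
  have ev : ∀ z : ℝ × ℝ, Continuous fun w : ℝ × ℝ →ᵇ ℝ => w z := fun z =>
    continuous_eval_const z
  have e : {w : ℝ × ℝ →ᵇ ℝ | (∀ x t, |φ t * w (x, t)| ≤ ψ t) ∧ ∀ x, ∀ t ≤ 0, w (x, t) = 0} =
      (⋂ x, ⋂ t, {w : ℝ × ℝ →ᵇ ℝ | |φ t * w (x, t)| ≤ ψ t}) ∩
      ⋂ x, ⋂ t, ⋂ (_ : t ≤ 0), {w : ℝ × ℝ →ᵇ ℝ | w (x, t) = 0} := by
    ext w
    simp only [mem_inter_iff, mem_iInter]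
    rfl
  rw [e]
  exact (isClosed_iInter fun x => isClosed_iInter fun t =>
    isClosed_le (continuous_const.mul (ev (x, t))).abs continuous_const).inter
    (isClosed_iInter fun x => isClosed_iInter fun t => isClosed_iInter fun _ =>
      isClosed_eq (ev (x, t)) continuous_const)

/-- Existence for the time-differentiated system `V = h - W[β(∫V) V]`, by contraction. -/
theorem exists_velocityRate {T L Λ M : ℝ} (hT : 0 < T) (hL0 : 0 < L) (hM : 0 ≤ M) {β : ℝ → ℝ}
    (hL : ∀ x, |β x| ≤ L) (hΛ0 : 0 ≤ Λ) (hΛ : ∀ x y, |β y - β x| ≤ Λ * |y - x|)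
    {h : ℝ → ℝ → ℝ} (hh : Continuous (Function.uncurry h))
    (h0 : ∀ x ∈ Icc (0 : ℝ) 1, h x 0 = 0) (hhM : ∀ x t, |h x t| ≤ M) :
    ∃ V : ℝ → ℝ → ℝ, Continuous (Function.uncurry V) ∧ (∀ x, ∀ t ≤ 0, V x t = 0) ∧
      (∀ x t, |V x t| ≤ 2 * M * Real.exp (2 * L * T)) ∧
      ∀ x ∈ Icc (0 : ℝ) 1, ∀ t ∈ Icc 0 T,
        V x t = h x t - duhamelOdd (dampingRate β V) x t := by
  have hβ : Continuous β := by
    have : LipschitzWith Λ.toNNReal β := LipschitzWith.of_dist_le_mul fun x y => by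
      rw [Real.coe_toNNReal _ hΛ0, Real.dist_eq, Real.dist_eq]; exact hΛ y x
    exact this.continuous
  -- Uniform bound on the invariant set. It is needed because V ↦ β(∫V)V is Lipschitz only on
  -- bounded sets; μ is then taken so large that (L + ΛM₁)/μ ≤ 1/2.
  obtain ⟨M₁, hM₁⟩ : ∃ M₁, M₁ = 2 * M * Real.exp (2 * L * T) := ⟨_, rfl⟩
  have hM₁0 : 0 ≤ M₁ := by rw [hM₁]; positivity
  rw [← hM₁]
  obtain ⟨μ, hμ⟩ : ∃ μ, μ = 2 * (L + Λ * M₁) + 1 := ⟨_, rfl⟩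
  have hμ1 : 1 ≤ μ := by rw [hμ]; nlinarith [mul_nonneg hΛ0 hM₁0]
  have hμ0 : 0 < μ := one_pos.trans_le hμ1
  let ct := clampTo T
  have hct : ∀ t, ct t ∈ Icc 0 T := clampTo_mem hT.le
  have cct : Continuous ct := continuous_clampTo T
  -- The candidate V is `W w`, so the sup norm of w is the weighted norm of V. Clamping the time
  -- keeps the weight bounded on all of ℝ.
  let W : (ℝ × ℝ →ᵇ ℝ) → ℝ → ℝ → ℝ := fun w x t => Real.exp (μ * ct t) * w (x, t)
  have cW : ∀ w, Continuous (Function.uncurry (W w)) := fun w =>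
    (Real.continuous_exp.comp (continuous_const.mul (cct.comp continuous_snd))).mul w.continuous
  let S : Set (ℝ × ℝ →ᵇ ℝ) := {w | (∀ x t, |W w x t| ≤ 2 * M * Real.exp ((2 * L) * ct t)) ∧
    ∀ x, ∀ t ≤ 0, w (x, t) = 0}
  have hSc : IsClosed S := isClosed_boundedContinuous_weighted _ _
  have zW : ∀ w ∈ S, ∀ x, ∀ t ≤ 0, W w x t = 0 := fun w hw x t ht => by
    show Real.exp (μ * ct t) * w (x, t) = 0
    rw [hw.2 x t ht, mul_zero]
  have bW : ∀ w ∈ S, ∀ x t, |W w x t| ≤ M₁ := fun w hw x t => (hw.1 x t).trans <| by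
    have := (hct t).2
    rw [hM₁]; gcongr
  -- Clamping x to [0,1] lets the condition h(x,0) = 0 give zero values at nonpositive times for
  -- every real x.
  let R : (ℝ × ℝ →ᵇ ℝ) → ℝ → ℝ → ℝ := fun w x t =>
    h (clampTo 1 x) (ct t) - duhamelOdd (dampingRate β (W w)) (clampTo 1 x) (ct t)
  have cR : ∀ w ∈ S, Continuous (Function.uncurry (R w)) := fun w hw => by
    have c1 : Continuous fun z : ℝ × ℝ => clampTo 1 z.1 :=
      (continuous_clampTo 1).comp continuous_fst
    have c2 : Continuous fun z : ℝ × ℝ => ct z.2 := cct.comp continuous_snd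
    exact (hh.comp_uncurry c1 c2).sub ((continuous_duhamelOdd (continuous_dampingRate hβ (cW w))
      (dampingRate_eq_zero β (zW w hw))).comp_uncurry c1 c2)
  have bR : ∀ w ∈ S, ∀ x t, |R w x t| ≤ 2 * M * Real.exp ((2 * L) * ct t) := fun w hw x t => by
    refine abs_sub_duhamelOdd_dampingRate_le hL0 hM hL (hhM _ _) (hct t).1 (fun y s hs => ?_) _
    have e : ct s = s := clampTo_of_mem ⟨hs.1, hs.2.trans (hct t).2⟩
    have := hw.1 y s
    rwa [e] at this
  have zR : ∀ w ∈ S, ∀ x, ∀ t ≤ 0, R w x t = 0 := fun w hw x t ht => by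
    show h (clampTo 1 x) (clampTo T t) - duhamelOdd _ (clampTo 1 x) (clampTo T t) = 0
    rw [clampTo_of_nonpos ht, h0 _ (clampTo_mem zero_le_one x)]
    simp [duhamelOdd, duhamel]
  have eW : ∀ (r : ℝ → ℝ → ℝ) (x t : ℝ), Real.exp (μ * ct t) * (Real.exp (-(μ * ct t)) * r x t) =
      r x t := fun r x t => by rw [← mul_assoc, ← Real.exp_add]; simp
  have eneg : ∀ t, Real.exp (-(μ * ct t)) ≤ 1 := fun t =>
    Real.exp_le_one_iff.2 (neg_nonpos.2 (mul_nonneg hμ0.le (hct t).1))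
  let Ψ : S → S := fun w => ⟨BoundedContinuousFunction.ofNormedAddCommGroup
    (fun z => Real.exp (-(μ * ct z.2)) * R w.1 z.1 z.2)
    ((Real.continuous_exp.comp ((continuous_const.mul (cct.comp continuous_snd)).neg)).mul
      (cR w.1 w.2)) M₁ (fun z => by
        rw [norm_mul, Real.norm_eq_abs, Real.norm_eq_abs, Real.abs_exp]
        refine (mul_le_of_le_one_left (abs_nonneg _) (eneg _)).trans
          ((bR w.1 w.2 z.1 z.2).trans ?_)
        have := (hct z.2).2
        rw [hM₁]; gcongr), by
    refine ⟨fun x t => ?_, fun x t ht => ?_⟩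
    · show |Real.exp (μ * ct t) * (Real.exp (-(μ * ct t)) * R w.1 x t)| ≤ _
      rw [eW]
      exact bR w.1 w.2 x t
    · show Real.exp (-(μ * ct t)) * R w.1 x t = 0
      rw [zR w.1 w.2 x t ht, mul_zero]⟩
  have hΨ : ContractingWith (1 / 2) Ψ := by
    refine ⟨by rw [← NNReal.coe_lt_coe]; norm_num, LipschitzWith.of_dist_le_mul fun w w' => ?_⟩
    rw [Subtype.dist_eq, Subtype.dist_eq]
    obtain ⟨d, hd⟩ : ∃ d, d = dist (w : ℝ × ℝ →ᵇ ℝ) (w' : ℝ × ℝ →ᵇ ℝ) := ⟨_, rfl⟩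
    rw [← hd]
    have hd0 : 0 ≤ d := hd ▸ dist_nonneg
    rw [BoundedContinuousFunction.dist_le (by positivity)]
    rintro ⟨x, t⟩
    show dist (Real.exp (-(μ * ct t)) * R w.1 x t) (Real.exp (-(μ * ct t)) * R w'.1 x t) ≤ _
    have hdiff := abs_duhamelOdd_dampingRate_sub_le hM₁0 hL hΛ0 hΛ hμ hd0 (hct t).1 hβ (cW w.1)
      (cW w'.1) (bW _ w'.2) (fun y r hr => by
        have e : ct r = r := clampTo_of_mem ⟨hr.1, hr.2.trans (hct t).2⟩
        show |Real.exp (μ * ct r) * w.1 (y, r) - Real.exp (μ * ct r) * w'.1 (y, r)| ≤ _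
        rw [← mul_sub, abs_mul, Real.abs_exp, e, mul_comm d]
        refine mul_le_mul_of_nonneg_left ?_ (Real.exp_pos _).le
        rw [← Real.dist_eq, hd]
        exact BoundedContinuousFunction.dist_coe_le_dist _) (clampTo 1 x)
    rw [Real.dist_eq, ← mul_sub, abs_mul, Real.abs_exp]
    have e1 : R w.1 x t - R w'.1 x t = -(duhamelOdd (dampingRate β (W w.1)) (clampTo 1 x) (ct t) -
        duhamelOdd (dampingRate β (W w'.1)) (clampTo 1 x) (ct t)) := by
      simp only [R]; ring
    rw [e1, abs_neg]
    have e2 : Real.exp (-(μ * ct t)) * (1 / 2 * d * Real.exp (μ * ct t)) = 1 / 2 * d := by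
      rw [mul_comm, mul_assoc, ← Real.exp_add]; simp
    refine (mul_le_mul_of_nonneg_left hdiff (Real.exp_pos _).le).trans ?_
    rw [e2]
    norm_num
  have : CompleteSpace S := hSc.completeSpace_coe
  have : Nonempty S := ⟨⟨0, fun x t => by simp [W]; positivity, fun x t _ => rfl⟩⟩
  obtain ⟨w, hw⟩ : ∃ w, Ψ w = w := ⟨_, hΨ.fixedPoint_isFixedPt⟩
  have hfix : ∀ x t, W w.1 x t = R w.1 x t := fun x t => by
    have h1 : Real.exp (-(μ * ct t)) * R w.1 x t = w.1 (x, t) := by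
      conv_rhs => rw [← hw]
      rfl
    show Real.exp (μ * ct t) * w.1 (x, t) = _
    rw [← h1, eW]
  refine ⟨W w.1, cW _, zW _ w.2, bW _ w.2, fun x hx t ht => ?_⟩
  rw [hfix]
  show h (clampTo 1 x) (clampTo T t) - duhamelOdd _ (clampTo 1 x) (clampTo T t) = _
  rw [clampTo_of_mem hx, clampTo_of_mem ht]

/-! ### Existence of classical solutions -/

theorem duhamel_congr {k k' : ℝ → ℝ → ℝ} {t : ℝ} (ht : 0 ≤ t)
    (h : ∀ y ∈ Icc (0 : ℝ) 1, ∀ s ∈ Icc 0 t, k y s = k' y s) (x : ℝ) :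
    duhamel k x t = duhamel k' x t := by
  refine intervalIntegral.integral_congr fun s hs => ?_
  rw [uIcc_of_le ht] at hs
  simp only [h _ (foldUnit_mem _) s hs]

theorem duhamelOdd_zero_left (k : ℝ → ℝ → ℝ) (t : ℝ) : duhamelOdd k 0 t = 0 := by
  simp [duhamelOdd]

/-- The points 1 and -1 agree modulo the period 2. -/
theorem duhamelOdd_one_left (k : ℝ → ℝ → ℝ) (t : ℝ) : duhamelOdd k 1 t = 0 := by
  have := duhamel_add_two k (-1) t
  rw [show (-1 : ℝ) + 2 = 1 by norm_num] at this
  rw [duhamelOdd, this, sub_self, zero_div]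

theorem duhamelOdd_zero_right (k : ℝ → ℝ → ℝ) (x : ℝ) : duhamelOdd k x 0 = 0 := by
  simp [duhamelOdd, duhamel]

theorem duhamelEven_zero_right (k : ℝ → ℝ → ℝ) (x : ℝ) : duhamelEven k x 0 = 0 := by
  simp [duhamelEven, duhamel]

/-- A source term `k` with time derivative `k'`, both vanishing for nonpositive times. -/
structure IsDuhamelSource (k k' : ℝ → ℝ → ℝ) : Prop where
  cont : Continuous (Function.uncurry k)
  cont' : Continuous (Function.uncurry k')
  zero : ∀ y, ∀ s ≤ 0, k y s = 0
  zero' : ∀ y, ∀ s ≤ 0, k' y s = 0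
  deriv : ∀ y ∈ Icc (0 : ℝ) 1, ∀ s, HasDerivAt (k y) (k' y s) s

namespace IsDuhamelSource

variable {k k' : ℝ → ℝ → ℝ}

theorem hasDerivAt_time (h : IsDuhamelSource k k') (x t : ℝ) :
    HasDerivAt (duhamel k x) (duhamel k' x t) t :=
  hasDerivAt_duhamel_time h.cont h.cont' h.zero h.zero' h.deriv x t

theorem hasDerivAt_odd_time (h : IsDuhamelSource k k') (x t : ℝ) :
    HasDerivAt (duhamelOdd k x) (duhamelOdd k' x t) t :=
  ((h.hasDerivAt_time x t).sub (h.hasDerivAt_time (-x) t)).div_const 2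

theorem hasDerivAt_even_time (h : IsDuhamelSource k k') (x t : ℝ) :
    HasDerivAt (duhamelEven k x) (duhamelEven k' x t) t :=
  ((h.hasDerivAt_time x t).add (h.hasDerivAt_time (-x) t)).div_const 2

theorem hasDerivAt_reflected (h : IsDuhamelSource k k') {x : ℝ} (hx : x ∈ Ioo (0 : ℝ) 1) (t : ℝ) :
    HasDerivAt (fun y => duhamel k y t) (k x t - duhamel k' x t) x ∧
      HasDerivAt (fun y => duhamel k (-y) t) (k x t + duhamel k' (-x) t) x := by
  have hs := (sin_pi_mul_pos hx).ne'
  have h1 := hasDerivAt_duhamel_space h.cont h.cont' h.zero h.zero' h.deriv t hs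
  have h2 := hasDerivAt_duhamel_space h.cont h.cont' h.zero h.zero' h.deriv (x := -x) t
    (by rwa [mul_neg, Real.sin_neg, neg_ne_zero])
  rw [squareWave_of_mem hx, foldUnit_of_mem (Ioo_subset_Icc_self hx), one_mul] at h1
  rw [squareWave_neg, foldUnit_neg, squareWave_of_mem hx,
    foldUnit_of_mem (Ioo_subset_Icc_self hx)] at h2
  refine ⟨h1, ?_⟩
  have h3 := HasDerivAt.comp (h₂ := fun y => duhamel k y t) x h2 (hasDerivAt_neg x)
  convert! h3 using 1
  ring

theorem hasDerivAt_odd_space (h : IsDuhamelSource k k') {x : ℝ} (hx : x ∈ Ioo (0 : ℝ) 1) (t : ℝ) :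
    HasDerivAt (fun y => duhamelOdd k y t) (-duhamelEven k' x t) x := by
  obtain ⟨h1, h2⟩ := h.hasDerivAt_reflected hx t
  convert! (h1.sub h2).div_const 2 using 1
  unfold duhamelEven
  ring

theorem hasDerivAt_even_space (h : IsDuhamelSource k k') {x : ℝ} (hx : x ∈ Ioo (0 : ℝ) 1) (t : ℝ) :
    HasDerivAt (fun y => duhamelEven k y t) (k x t - duhamelOdd k' x t) x := by
  obtain ⟨h1, h2⟩ := h.hasDerivAt_reflected hx t
  convert! (h1.add h2).div_const 2 using 1
  unfold duhamelOdd
  ring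

end IsDuhamelSource

/-- Mild form of the damped wave system, relative to a solution `(ph, uh)` of the undamped one. -/
structure IsMildSolution (T : ℝ) (uh ph : ℝ → ℝ → ℝ) (b : ℝ → ℝ) (p u : ℝ → ℝ → ℝ) : Prop where
  cont_p : Continuous (Function.uncurry p)
  cont_u : Continuous (Function.uncurry u)
  eq_u : ∀ x ∈ Icc (0 : ℝ) 1, ∀ t ∈ Icc 0 T,
    u x t = uh x t - duhamelOdd (fun y s => b (u y s)) x t
  eq_p : ∀ x ∈ Icc (0 : ℝ) 1, ∀ t ∈ Icc 0 T,
    p x t = ph x t - duhamelEven (fun y s => b (u y s)) x t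

/-- Put v = ∫V and k = b(v), and let u and p be the lift minus the odd and even Duhamel parts of k.
The integral equation for V says exactly that ∂ₜu = V on [0,T], whence u = v and the source is b(u).
The velocity bound comes from integrating the bound on V, which involves b only through a₁. -/
theorem exists_classicalSolution {T c : ℝ} (hT : 0 < T) {g₀ g₁ : ℝ → ℝ}
    {uh uht ph pht : ℝ → ℝ → ℝ} {M : ℝ} (hl : IsBoundaryLift T c g₀ g₁ uh uht ph pht M)
    {a₀ a₁ a₂ a₃ : ℝ} (ha₀ : 0 < a₀) {b b₁ b₂ : ℝ → ℝ}
    (hb : IsDampingJet a₀ a₁ a₂ a₃ b b₁ b₂) :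
    ∃ p u, IsClassicalSolution T c g₀ g₁ b p u ∧ IsMildSolution T uh ph b p u ∧
      ∀ x ∈ Icc (0 : ℝ) 1, ∀ t ∈ Icc 0 T, |u x t| ≤ 2 * M * Real.exp (2 * a₁ * T) * T := by
  have ha₁ : 0 < a₁ := ha₀.trans_le ((hb.lower 0).trans (hb.upper 0))
  have ha₂ : 0 ≤ a₂ := (abs_nonneg _).trans (hb.bound 0)
  obtain ⟨V, cV, zV, bV, eV⟩ := exists_velocityRate hT ha₁ hl.bound_nonneg
    (hb.abs_deriv_le ha₀.le) ha₂ hb.abs_deriv_sub_le hl.cont_ut (fun x hx => (hl.initial x hx).2.1)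
    hl.bound
  have cb : Continuous b := continuous_iff_continuousAt.2 fun x => (hb.hasDerivAt x).continuousAt
  have cb₁ : Continuous b₁ :=
    continuous_iff_continuousAt.2 fun x => (hb.hasDerivAt_deriv x).continuousAt
  let v : ℝ → ℝ → ℝ := fun y s => ∫ r in (0 : ℝ)..s, V y r
  have cv : Continuous (Function.uncurry v) := continuous_timePrimitive cV
  have dv : ∀ y s, HasDerivAt (v y) (V y s) s := fun y s =>
    ((cV.comp_uncurry continuous_const continuous_id).integral_hasStrictDerivAt 0 s).hasDerivAt
  obtain ⟨k, hk⟩ : ∃ k : ℝ → ℝ → ℝ, k = fun y s => b (v y s) := ⟨_, rfl⟩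
  obtain ⟨k', hk'⟩ : ∃ k', k' = dampingRate b₁ V := ⟨_, rfl⟩
  rw [← hk'] at eV
  have ck : Continuous (Function.uncurry k) := by rw [hk]; exact cb.comp cv
  have ck' : Continuous (Function.uncurry k') := by rw [hk']; exact continuous_dampingRate cb₁ cV
  have zk : ∀ y, ∀ s ≤ 0, k y s = 0 := fun y s hs => by
    simp only [hk, v]
    rw [timePrimitive_eq_zero zV y hs, hb.zero]
  have zk' : ∀ y, ∀ s ≤ 0, k' y s = 0 := by rw [hk']; exact dampingRate_eq_zero b₁ zV
  have dk : ∀ y ∈ Icc (0 : ℝ) 1, ∀ s, HasDerivAt (k y) (k' y s) s := fun y _ s => by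
    rw [hk, hk']
    exact (hb.hasDerivAt (v y s)).comp s (dv y s)
  have src : IsDuhamelSource k k' := ⟨ck, ck', zk, zk', dk⟩
  let u : ℝ → ℝ → ℝ := fun x t => uh x t - duhamelOdd k x t
  let p : ℝ → ℝ → ℝ := fun x t => ph x t - duhamelEven k x t
  have cO := continuous_duhamelOdd ck zk
  have cO' := continuous_duhamelOdd ck' zk'
  have cE := continuous_duhamelEven ck zk
  have cE' := continuous_duhamelEven ck' zk'
  have cu : Continuous (Function.uncurry u) := hl.cont_u.sub cO
  have cp : Continuous (Function.uncurry p) := hl.cont_p.sub cE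
  have du : ∀ x t, HasDerivAt (u x) (uht x t - duhamelOdd k' x t) t := fun x t =>
    (hl.deriv_ut x t).sub (src.hasDerivAt_odd_time x t)
  -- Both sides have time derivative V and vanish at t = 0.
  have huv : ∀ x ∈ Icc (0 : ℝ) 1, ∀ t ∈ Icc 0 T, u x t = v x t := by
    intro x hx t ht
    have hder : ∀ s ∈ Icc 0 T, HasDerivAt (fun s => u x s - v x s) 0 s := fun s hs => by
      have := (du x s).sub (dv x s)
      rwa [← eV x hx s hs, sub_self] at this
    have h1 := constant_of_has_deriv_right_zero (f := fun s => u x s - v x s) (a := 0) (b := T)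
      (fun s hs => (hder s hs).continuousAt.continuousWithinAt)
      (fun s hs => (hder s (Ico_subset_Icc_self hs)).hasDerivWithinAt) t ht
    have h2 : u x 0 - v x 0 = 0 := by
      simp [u, v, duhamelOdd_zero_right, (hl.initial x hx).1]
    simp only [h2] at h1
    linarith
  have hku : ∀ y ∈ Icc (0 : ℝ) 1, ∀ s ∈ Icc 0 T, k y s = b (u y s) := fun y hy s hs => by
    rw [huv y hy s hs, hk]
  refine ⟨p, u, ?_, ⟨cp, cu, fun x _ t ht => ?_, fun x _ t ht => ?_⟩, fun x hx t ht => ?_⟩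
  · refine isClassicalSolution_of_hasDerivAt hT
      (pt := fun x t => pht x t - duhamelEven k' x t)
      (px := fun x t => -uht x t - (k x t - duhamelOdd k' x t))
      (ut := fun x t => uht x t - duhamelOdd k' x t)
      (ux := fun x t => -pht x t - -duhamelEven k' x t)
      cp (hl.cont_pt.sub cE') (hl.cont_ut.neg.sub (ck.sub cO')) cu (hl.cont_ut.sub cO')
      (hl.cont_pt.neg.sub cE'.neg)
      (fun x _ t => (hl.deriv_pt x t).sub (src.hasDerivAt_even_time x t))
      (fun x hx t => (hl.deriv_px x t).sub (src.hasDerivAt_even_space hx t))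
      (fun x _ t => du x t)
      (fun x hx t => (hl.deriv_ux x t).sub (src.hasDerivAt_odd_space hx t))
      (fun t _ x _ => by ring)
      (fun t ht x hx => by
        rw [hku x (Ioo_subset_Icc_self hx) t ht]; ring)
      (fun t ht => ?_) (fun x hx => ?_)
    · simp only [u, duhamelOdd_zero_left, duhamelOdd_one_left, sub_zero]
      exact hl.boundary t ht
    · simp only [u, p, duhamelOdd_zero_right, duhamelEven_zero_right, sub_zero]
      exact ⟨(hl.initial x hx).2.2, (hl.initial x hx).1⟩
  · have := duhamel_congr ht.1 fun y hy s hs => hku y hy s ⟨hs.1, hs.2.trans ht.2⟩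
    show uh x t - (duhamel k x t - duhamel k (-x) t) / 2 = _
    rw [this, this]
    rfl
  · have := duhamel_congr ht.1 fun y hy s hs => hku y hy s ⟨hs.1, hs.2.trans ht.2⟩
    show ph x t - (duhamel k x t + duhamel k (-x) t) / 2 = _
    rw [this, this]
    rfl
  · rw [huv x hx t ht]
    have h1 := intervalIntegral.norm_integral_le_of_norm_le_const (a := 0) (b := t) (f := V x)
      fun s _ => bV x s
    rw [sub_zero, abs_of_nonneg ht.1] at h1
    refine h1.trans ?_
    have := hl.bound_nonneg
    have := ht.2
    gcongr

/-! ### Stability and compactness of pressure drops -/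

/-- Lipschitz stability of mild solutions with respect to the damping law. -/
theorem IsMildSolution.abs_pressure_sub_le {T L C ε : ℝ} (hT : 0 ≤ T) (hL : 0 ≤ L) (hε : 0 ≤ ε)
    {uh ph : ℝ → ℝ → ℝ} {b b' : ℝ → ℝ} {p u p' u' : ℝ → ℝ → ℝ}
    (h : IsMildSolution T uh ph b p u) (h' : IsMildSolution T uh ph b' p' u')
    (hb : Continuous b) (hb' : Continuous b') (hlip : ∀ x y, |b' y - b' x| ≤ L * |y - x|)
    (hC : ∀ x ∈ Icc (0 : ℝ) 1, ∀ t ∈ Icc 0 T, |u x t| ≤ C)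
    (hbb : ∀ v, |v| ≤ C → |b' v - b v| ≤ ε) {x t : ℝ} (hx : x ∈ Icc (0 : ℝ) 1)
    (ht : t ∈ Icc 0 T) : |p' x t - p x t| ≤ ε * Real.exp ((2 * L + 2) * T) := by
  -- With this rate the weighted maximum δ of |u' - u| satisfies δ ≤ (Lδ + ε)/(2L + 2), hence δ ≤ ε.
  -- The same quotient then bounds the weighted pressure difference.
  set μ := 2 * L + 2 with hμ
  have hμ0 : 0 < μ := by positivity
  obtain ⟨⟨x₀, t₀⟩, ⟨hx₀, ht₀⟩, hmax⟩ :=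
    ((isCompact_Icc (a := (0 : ℝ)) (b := 1)).prod (isCompact_Icc (a := 0) (b := T))).exists_isMaxOn
      ⟨(0, 0), ⟨left_mem_Icc.2 zero_le_one, left_mem_Icc.2 hT⟩⟩
      (f := fun z : ℝ × ℝ => Real.exp (-(μ * z.2)) * |u' z.1 z.2 - u z.1 z.2|)
      ((Real.continuous_exp.comp (by fun_prop)).mul (h'.cont_u.sub h.cont_u).abs).continuousOn
  set δ := Real.exp (-(μ * t₀)) * |u' x₀ t₀ - u x₀ t₀| with hδ
  have hδ0 : 0 ≤ δ := by positivity
  have hexp : ∀ s r q : ℝ, Real.exp (-(μ * s)) * r ≤ q ↔ r ≤ q * Real.exp (μ * s) := fun s r q => by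
    rw [Real.exp_neg, inv_mul_le_iff₀ (Real.exp_pos _), mul_comm q]
  have hδle : ∀ y ∈ Icc (0 : ℝ) 1, ∀ s ∈ Icc 0 T, |u' y s - u y s| ≤ δ * Real.exp (μ * s) :=
    fun y hy s hs => (hexp s _ _).1 (hmax (a := (y, s)) ⟨hy, hs⟩)
  have hsrc : ∀ y ∈ Icc (0 : ℝ) 1, ∀ s ∈ Icc 0 T,
      |b' (u' y s) - b (u y s)| ≤ (L * δ + ε) * Real.exp (μ * s) := by
    intro y hy s hs
    have h1 := hlip (u y s) (u' y s)
    have h2 := hbb _ (hC y hy s hs)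
    have h3 := mul_le_mul_of_nonneg_left (hδle y hy s hs) hL
    have h4 : 1 ≤ Real.exp (μ * s) := Real.one_le_exp (mul_nonneg hμ0.le hs.1)
    have h5 := le_mul_of_one_le_right hε h4
    have h6 := abs_sub_le (b' (u' y s)) (b' (u y s)) (b (u y s))
    linarith
  have cs : Continuous (Function.uncurry fun y s => b (u y s)) := hb.comp h.cont_u
  have cs' : Continuous (Function.uncurry fun y s => b' (u' y s)) := hb'.comp h'.cont_u
  have hsrc0 : 0 ≤ L * δ + ε := by positivity
  have hδε : δ ≤ ε := by
    have h1 : |u' x₀ t₀ - u x₀ t₀| ≤ (L * δ + ε) / μ * Real.exp (μ * t₀) := by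
      rw [h.eq_u x₀ hx₀ t₀ ht₀, h'.eq_u x₀ hx₀ t₀ ht₀, sub_sub_sub_cancel_left, abs_sub_comm,
        duhamelOdd_sub cs' cs]
      exact abs_duhamelOdd_le hsrc0 hμ0 ht₀.1
        (fun y hy s hs => hsrc y hy s ⟨hs.1, hs.2.trans ht₀.2⟩) _
    have h2 : δ ≤ (L * δ + ε) / μ := (hexp t₀ _ _).2 h1
    rw [le_div_iff₀ hμ0, hμ] at h2
    nlinarith
  have h1 : |p' x t - p x t| ≤ (L * δ + ε) / μ * Real.exp (μ * t) := by
    rw [h.eq_p x hx t ht, h'.eq_p x hx t ht, sub_sub_sub_cancel_left, abs_sub_comm,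
      duhamelEven_sub cs' cs]
    exact abs_duhamelEven_le hsrc0 hμ0 ht.1
      (fun y hy s hs => hsrc y hy s ⟨hs.1, hs.2.trans ht.2⟩) _
  refine h1.trans ?_
  have h2 : (L * δ + ε) / μ ≤ ε := by
    rw [div_le_iff₀ hμ0, hμ]
    nlinarith
  have := ht.2
  gcongr

/-- An ε/3 argument on small balls, joined by compact induction. The radius uses L + 1 so that L = 0
causes no division by zero. -/
theorem eventually_forall_abs_sub_le_of_lipschitz {ι : Type*} {l : Filter ι} {b : ι → ℝ → ℝ}
    {c : ℝ → ℝ} {L : ℝ} (hL : 0 ≤ L) (hb : ∀ᶠ i in l, ∀ x y, |b i y - b i x| ≤ L * |y - x|)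
    (hc : ∀ x y, |c y - c x| ≤ L * |y - x|) (hlim : ∀ x, Tendsto (fun i => b i x) l (𝓝 (c x)))
    {K : Set ℝ} (hK : IsCompact K) {ε : ℝ} (hε : 0 < ε) :
    ∀ᶠ i in l, ∀ v ∈ K, |b i v - c v| ≤ ε := by
  refine hK.induction_on (p := fun s => ∀ᶠ i in l, ∀ v ∈ s, |b i v - c v| ≤ ε) (by simp)
    (fun s s' hss h => h.mono fun i hi v hv => hi v (hss hv))
    (fun s s' h h' => (h.and h').mono fun i hi v hv => hv.elim (hi.1 v) (hi.2 v)) ?_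
  intro x _
  refine ⟨Metric.ball x (ε / (3 * (L + 1))),
    mem_nhdsWithin_of_mem_nhds (Metric.ball_mem_nhds _ (by positivity)), ?_⟩
  filter_upwards [hb, Metric.tendsto_nhds.1 (hlim x) (ε / 3) (by positivity)] with i h1 h2 v hv
  rw [Metric.mem_ball, Real.dist_eq] at hv
  rw [Real.dist_eq] at h2
  have h3 : L * |v - x| ≤ ε / 3 := by
    have h4 : (L + 1) * |v - x| ≤ (L + 1) * (ε / (3 * (L + 1))) :=
      mul_le_mul_of_nonneg_left hv.le (by positivity)
    rw [show (L + 1) * (ε / (3 * (L + 1))) = ε / 3 by field_simp] at h4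
    linarith [abs_nonneg (v - x)]
  have e1 := abs_le.1 ((h1 x v).trans h3)
  have e2 := abs_le.1 ((hc x v).trans h3)
  have e3 := abs_lt.1 h2
  rw [abs_le]
  constructor <;> linarith [e1.1, e1.2, e2.1, e2.2, e3.1, e3.2]

/-- `y` is the pressure drop of a mild solution for the damping law `b` whose velocity is bounded
by `C`. -/
def IsMildPressureDrop (T C : ℝ) (uh ph : ℝ → ℝ → ℝ) (b : ℝ → ℝ) (y : L2Interval 0 T) : Prop :=
  ∃ p u, IsMildSolution T uh ph b p u ∧
    (∀ x ∈ Icc (0 : ℝ) 1, ∀ t ∈ Icc 0 T, |u x t| ≤ C) ∧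
    y =ᵐ[volume.restrict (Ioo 0 T)] fun t => p 0 t - p 1 t

theorem IsDampingJet.continuous {a₀ a₁ a₂ a₃ : ℝ} {b b₁ b₂ : ℝ → ℝ}
    (h : IsDampingJet a₀ a₁ a₂ a₃ b b₁ b₂) : Continuous b :=
  continuous_iff_continuousAt.2 fun x => (h.hasDerivAt x).continuousAt

theorem IsDampingJet.monotone {a₀ a₁ a₂ a₃ : ℝ} {b b₁ b₂ : ℝ → ℝ}
    (h : IsDampingJet a₀ a₁ a₂ a₃ b b₁ b₂) (ha₀ : 0 ≤ a₀) : Monotone b :=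
  monotone_of_deriv_nonneg (fun x => (h.hasDerivAt x).differentiableAt) fun x => by
    rw [(h.hasDerivAt x).deriv]; exact ha₀.trans (h.lower x)

/-- Pointwise convergence of admissible damping laws implies convergence of the pressure drops. -/
theorem tendsto_pressureDrop {T C : ℝ} (hT : 0 < T) {uh ph : ℝ → ℝ → ℝ}
    {a₀ a₁ a₂ a₃ : ℝ} (ha₀ : 0 ≤ a₀) {ι : Type*} {l : Filter ι} {b b₁ b₂ : ι → ℝ → ℝ}
    {c c₁ c₂ : ℝ → ℝ} {y : ι → L2Interval 0 T} {z : L2Interval 0 T}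
    (hb : ∀ᶠ i in l, IsDampingJet a₀ a₁ a₂ a₃ (b i) (b₁ i) (b₂ i))
    (hy : ∀ᶠ i in l, IsMildPressureDrop T C uh ph (b i) (y i))
    (hc : IsDampingJet a₀ a₁ a₂ a₃ c c₁ c₂) (hz : IsMildPressureDrop T C uh ph c z)
    (hlim : ∀ x, Tendsto (fun i => b i x) l (𝓝 (c x))) : Tendsto y l (𝓝 z) := by
  have ha₁ : 0 ≤ a₁ := ha₀.trans ((hc.lower 0).trans (hc.upper 0))
  obtain ⟨p, u, hm, hbd, hzp⟩ := hz
  refine L2Interval.tendsto_of_uniform fun ε hε => ?_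
  set E := Real.exp ((2 * a₁ + 2) * T) with hE
  have hE0 : 0 < E := Real.exp_pos _
  -- Closeness ε/(2E) of the laws gives pressures within ε/2 at each end, hence drops within ε.
  have hunif := eventually_forall_abs_sub_le_of_lipschitz ha₁
    (hb.mono fun i hi => hi.abs_sub_le ha₀)
    (hc.abs_sub_le ha₀) hlim (isCompact_Icc (a := -C) (b := C)) (ε := ε / (2 * E)) (by positivity)
  filter_upwards [hb, hy, hunif] with i h1 h2 h3
  obtain ⟨p', u', hm', _, hyp⟩ := h2
  have key : ∀ x ∈ Icc (0 : ℝ) 1, ∀ t ∈ Icc 0 T, |p' x t - p x t| ≤ ε / 2 := fun x hx t ht => by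
    have := hm.abs_pressure_sub_le hT.le ha₁ (ε := ε / (2 * E)) (by positivity) hm' hc.continuous
      h1.continuous (h1.abs_sub_le ha₀) hbd (fun v hv => h3 v (abs_le.1 hv)) hx ht
    rwa [← hE, show ε / (2 * E) * E = ε / 2 by field_simp] at this
  filter_upwards [hyp, hzp, ae_restrict_mem measurableSet_Ioo] with t e1 e2 ht
  rw [e1, e2]
  have k0 := abs_le.1 (key 0 (left_mem_Icc.2 zero_le_one) t (Ioo_subset_Icc_self ht))
  have k1 := abs_le.1 (key 1 (right_mem_Icc.2 zero_le_one) t (Ioo_subset_Icc_self ht))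
  rw [abs_le]
  constructor <;> linarith [k0.1, k0.2, k1.1, k1.2]

/-- Choose a law for each drop. Along an ultrafilter these laws converge pointwise to an admissible
law, and by stability the drops converge to a drop of that law. -/
theorem isCompact_pressureDrops {T C : ℝ} (hT : 0 < T) {uh ph : ℝ → ℝ → ℝ}
    {a₀ a₁ a₂ a₃ : ℝ} (ha₀ : 0 ≤ a₀)
    (hex : ∀ b b₁ b₂, IsDampingJet a₀ a₁ a₂ a₃ b b₁ b₂ →
      ∃ y, IsMildPressureDrop T C uh ph b y) :
    IsCompact {y : L2Interval 0 T | ∃ b b₁ b₂, IsDampingJet a₀ a₁ a₂ a₃ b b₁ b₂ ∧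
      IsMildPressureDrop T C uh ph b y} := by
  rw [isCompact_iff_ultrafilter_le_nhds]
  intro U hU
  have hmem : ∀ᶠ y in (U : Filter (L2Interval 0 T)), ∃ b b₁ b₂,
    IsDampingJet a₀ a₁ a₂ a₃ b b₁ b₂ ∧ IsMildPressureDrop T C uh ph b y := le_principal_iff.1 hU
  choose! b b₁ b₂ hj hd using fun (y : L2Interval 0 T) (h : ∃ b b₁ b₂,
    IsDampingJet a₀ a₁ a₂ a₃ b b₁ b₂ ∧ IsMildPressureDrop T C uh ph b y) => h
  obtain ⟨c, c₁, c₂, hc, hlim⟩ := IsDampingJet.exists_ultrafilter_limit U ha₀ (hmem.mono hj)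
  obtain ⟨z, hz⟩ := hex c c₁ c₂ hc
  exact ⟨z, ⟨c, c₁, c₂, hc, hz⟩,
    tendsto_pressureDrop hT ha₀ (y := fun y => y) (hmem.mono hj) (hmem.mono hd) hc hz hlim⟩

/-! ### The forward operator -/

theorem eqOn_of_ae_eq_Ioo {α β : ℝ} (hαβ : α < β) {f g : ℝ → ℝ} (hf : Continuous f)
    (hg : Continuous g) (h : f =ᵐ[volume.restrict (Ioo α β)] g) : EqOn f g (Icc α β) := by
  rw [Measure.restrict_congr_set Ioo_ae_eq_Icc] at h
  exact Measure.eqOn_of_ae_eq h hf.continuousOn hg.continuousOn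
    (by rw [interior_Icc, closure_Ioo hαβ.ne])

/-- Only the values of the law on the range of the velocity enter the equations. -/
theorem IsClassicalSolution.congr_damping {T c : ℝ} {g₀ g₁ b b' : ℝ → ℝ} {p u : ℝ → ℝ → ℝ}
    (h : IsClassicalSolution T c g₀ g₁ b p u)
    (hbb : ∀ x ∈ Icc (0 : ℝ) 1, ∀ t ∈ Icc 0 T, b (u x t) = b' (u x t)) :
    IsClassicalSolution T c g₀ g₁ b' p u := by
  obtain ⟨P, U, h1, h2, h3, h4, h5, h6, h7, h8, h9⟩ := h
  refine ⟨P, U, h1, h2, h3, h4, h5, h6, h7, fun t ht => ?_, h9⟩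
  filter_upwards [h8 t ht, ae_restrict_mem measurableSet_Ioo] with x hx hx'
  rw [← hbb x (Ioo_subset_Icc_self hx') t ht]
  exact hx

/-- The weak derivative of order `0` as a continuous linear map. -/
noncomputable def toL2CLM (α β : ℝ) : SobolevSpace 2 α β →L[ℝ] L2Interval α β :=
  (PiLp.proj 2 (fun _ : Fin 3 => L2Interval α β) 0).comp (SobolevSpace 2 α β).subtypeL

/-- Testing the zeroth component against v ∈ L² is a continuous functional on H², so the weak and
strong limits have the same inner products with every v. -/
theorem eq_of_tendsto_weak {ι : Type*} {l : Filter ι} [l.NeBot] {α β : ℝ}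
    {a : ι → SobolevSpace 2 α β} {a' : SobolevSpace 2 α β} {f : L2Interval α β}
    (hw : Tendsto (fun i => toWeakSpace ℝ (SobolevSpace 2 α β) (a i)) l
      (𝓝 (toWeakSpace ℝ (SobolevSpace 2 α β) a')))
    (hs : Tendsto (fun i => weakDerivL2 0 (a i)) l (𝓝 f)) : weakDerivL2 0 a' = f := by
  refine ext_inner_left ℝ fun v => ?_
  let ℓ : SobolevSpace 2 α β →L[ℝ] ℝ := (innerSL ℝ v).comp (toL2CLM α β)
  have hcont : Continuous fun x : WeakSpace ℝ (SobolevSpace 2 α β) =>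
      topDualPairing ℝ (SobolevSpace 2 α β) ℓ ((toWeakSpace ℝ _).symm x) :=
    WeakBilin.eval_continuous (topDualPairing ℝ (SobolevSpace 2 α β)).flip ℓ
  have h1 : Tendsto (fun i => ℓ (a i)) l (𝓝 (ℓ a')) := (hcont.tendsto _).comp hw
  have h2 : Tendsto (fun i => ℓ (a i)) l (𝓝 (inner ℝ v f)) :=
    ((innerSL ℝ v).continuous.tendsto f).comp hs
  exact tendsto_nhds_unique h1 h2

theorem exists_mildPressureDrop {T c : ℝ} (hT : 0 < T) {g₀ g₁ : ℝ → ℝ}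
    {uh uht ph pht : ℝ → ℝ → ℝ} {M : ℝ} (hl : IsBoundaryLift T c g₀ g₁ uh uht ph pht M)
    {a₀ a₁ a₂ a₃ : ℝ} (ha₀ : 0 < a₀) {b b₁ b₂ : ℝ → ℝ}
    (hb : IsDampingJet a₀ a₁ a₂ a₃ b b₁ b₂) :
    ∃ y : L2Interval 0 T,
      IsMildPressureDrop T (2 * M * Real.exp (2 * a₁ * T) * T) uh ph b y ∧
      ∃ p u, IsClassicalSolution T c g₀ g₁ b p u ∧
        y =ᵐ[volume.restrict (Ioo 0 T)] fun t => p 0 t - p 1 t := by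
  obtain ⟨p, u, hcl, hm, hbd⟩ := exists_classicalSolution hT hl ha₀ hb
  have hc : Continuous fun t => p 0 t - p 1 t :=
    (hm.cont_p.comp_uncurry continuous_const continuous_id).sub
      (hm.cont_p.comp_uncurry continuous_const continuous_id)
  exact ⟨MemLp.toLp _ hc.continuousOn.memLp_Ioo, ⟨p, u, hm, hbd, MemLp.coeFn_toLp _⟩,
    p, u, hcl, MemLp.coeFn_toLp _⟩

/-- By uniqueness every classical solution coincides with the constructed one and inherits its
bound. Using C + 1 gives a nondegenerate interval even if C = 0. -/
theorem exists_velocityBounds {T c : ℝ} (hT : 0 < T) {g₀ g₁ : ℝ → ℝ}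
    {uh uht ph pht : ℝ → ℝ → ℝ} {M : ℝ} (hl : IsBoundaryLift T c g₀ g₁ uh uht ph pht M)
    {a₀ a₁ a₂ a₃ : ℝ} (ha₀ : 0 < a₀) (ha₂ : 0 < a₂) (ha₃ : 0 < a₃) :
    ∃ ul uu : ℝ, ul < uu ∧ AreVelocityBounds T c g₀ g₁ a₀ a₁ a₂ a₃ ul uu := by
  set C := 2 * M * Real.exp (2 * a₁ * T) * T with hC
  have hC0 : 0 ≤ C := by have := hl.bound_nonneg; positivity
  refine ⟨-(C + 1), C + 1, by linarith, fun a p u ha hs x hx t ht => ?_⟩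
  obtain ⟨b₁, b₂, hj⟩ := ha.exists_jet ha₂.le ha₃.le
  obtain ⟨p', u', hs', -, hbd⟩ := exists_classicalSolution hT hl ha₀ hj
  rw [(hs.unique hT (hj.monotone ha₀.le) hs' ht hx).2]
  have := abs_le.1 (hbd x hx t ht)
  constructor <;> linarith [this.1, this.2]

/-- Within velocity bounds, the pressure drop depends only on the restriction of the damping law. -/
theorem IsPressureDrop.eq {T c : ℝ} (hT : 0 < T) {g₀ g₁ : ℝ → ℝ} {a₀ a₁ a₂ a₃ : ℝ} (ha₀ : 0 < a₀)
    (ha₂ : 0 < a₂) (ha₃ : 0 < a₃) {ul uu : ℝ} (hu : ul < uu)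
    (hv : AreVelocityBounds T c g₀ g₁ a₀ a₁ a₂ a₃ ul uu) {a : SobolevSpace 2 ul uu}
    {y y' : L2Interval 0 T} (h : IsPressureDrop T c g₀ g₁ a₀ a₁ a₂ a₃ ul uu a y)
    (h' : IsPressureDrop T c g₀ g₁ a₀ a₁ a₂ a₃ ul uu a y') : y = y' := by
  obtain ⟨b, p, u, hb, hab, hs, hy⟩ := h
  obtain ⟨b', p', u', hb', hab', hs', hy'⟩ := h'
  -- The two laws agree on the closed interval, which contains every velocity, so both solutions
  -- solve the system for b.
  have heq := eqOn_of_ae_eq_Ioo hu hb'.1 hb.1 (hab'.symm.trans hab)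
  obtain ⟨b₁, b₂, hj⟩ := hb.exists_jet ha₂.le ha₃.le
  have hs'' := hs'.congr_damping (b' := b) fun x hx t ht => heq (hv b' p' u' hb' hs' x hx t ht)
  refine Lp.ext (hy.trans (EventuallyEq.trans ?_ hy'.symm))
  filter_upwards [ae_restrict_mem measurableSet_Ioo] with t ht
  have ht' := Ioo_subset_Icc_self ht
  rw [(hs.unique hT (hj.monotone ha₀.le) hs'' ht' (left_mem_Icc.2 zero_le_one)).1,
    (hs.unique hT (hj.monotone ha₀.le) hs'' ht' (right_mem_Icc.2 zero_le_one)).1]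

theorem forwardOperator_eq {T c : ℝ} (hT : 0 < T) {g₀ g₁ : ℝ → ℝ} {a₀ a₁ a₂ a₃ : ℝ} (ha₀ : 0 < a₀)
    (ha₂ : 0 < a₂) (ha₃ : 0 < a₃) {ul uu : ℝ} (hu : ul < uu)
    (hv : AreVelocityBounds T c g₀ g₁ a₀ a₁ a₂ a₃ ul uu) {a : SobolevSpace 2 ul uu}
    {y : L2Interval 0 T} (h : IsPressureDrop T c g₀ g₁ a₀ a₁ a₂ a₃ ul uu a y) :
    forwardOperator T c g₀ g₁ a₀ a₁ a₂ a₃ ul uu a = y := by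
  have hex : ∃ y, IsPressureDrop T c g₀ g₁ a₀ a₁ a₂ a₃ ul uu a y := ⟨y, h⟩
  rw [forwardOperator, dif_pos hex]
  exact IsPressureDrop.eq hT ha₀ ha₂ ha₃ hu hv hex.choose_spec h

theorem mainTheorem5 (T c : ℝ) (hT : 0 < T) (g₀ g₁ : ℝ → ℝ)
    (hg₀ : IsAdmissibleBoundaryData T g₀) (hg₁ : IsAdmissibleBoundaryData T g₁)
    (a₀ a₁ a₂ a₃ : ℝ) (ha₀ : 0 < a₀) (ha₁ : 0 < a₁) (ha₂ : 0 < a₂) (ha₃ : 0 < a₃) :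
    -- uniform bounds for the velocity exist
    (∃ ul uu : ℝ, ul < uu ∧ AreVelocityBounds T c g₀ g₁ a₀ a₁ a₂ a₃ ul uu) ∧
    -- and for every choice of them:
    ∀ ul uu : ℝ, ul < uu → AreVelocityBounds T c g₀ g₁ a₀ a₁ a₂ a₃ ul uu →
      -- the forward operator is well defined on its domain
      (∀ a ∈ forwardDomain a₀ a₁ a₂ a₃ ul uu,
        ∃! y, IsPressureDrop T c g₀ g₁ a₀ a₁ a₂ a₃ ul uu a y) ∧
      -- it maps weakly convergent sequences to strongly convergent ones
      (∀ (a : ℕ → SobolevSpace 2 ul uu) (a' : SobolevSpace 2 ul uu),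
        (∀ n, a n ∈ forwardDomain a₀ a₁ a₂ a₃ ul uu) →
        Tendsto (fun n => toWeakSpace ℝ (SobolevSpace 2 ul uu) (a n)) atTop
          (𝓝 (toWeakSpace ℝ (SobolevSpace 2 ul uu) a')) →
        a' ∈ forwardDomain a₀ a₁ a₂ a₃ ul uu ∧
        Tendsto (fun n => forwardOperator T c g₀ g₁ a₀ a₁ a₂ a₃ ul uu (a n)) atTop
          (𝓝 (forwardOperator T c g₀ g₁ a₀ a₁ a₂ a₃ ul uu a'))) ∧
      -- it is compact: continuous, with relatively compact images of bounded sets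
      ContinuousOn (forwardOperator T c g₀ g₁ a₀ a₁ a₂ a₃ ul uu)
        (forwardDomain a₀ a₁ a₂ a₃ ul uu) ∧
      (∀ B ⊆ forwardDomain a₀ a₁ a₂ a₃ ul uu, Bornology.IsBounded B →
        IsCompact (closure (forwardOperator T c g₀ g₁ a₀ a₁ a₂ a₃ ul uu '' B))) := by
  obtain ⟨uh, uht, ph, pht, M, hl⟩ := exists_boundaryLift hT c hg₀ hg₁
  refine ⟨exists_velocityBounds hT hl ha₀ ha₂ ha₃, fun ul uu hu hv => ?_⟩
  set F := forwardOperator T c g₀ g₁ a₀ a₁ a₂ a₃ ul uu with hF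
  set C := 2 * M * Real.exp (2 * a₁ * T) * T with hC
  have hdrop : ∀ (a : SobolevSpace 2 ul uu) (b b₁ b₂ : ℝ → ℝ),
      IsDampingJet a₀ a₁ a₂ a₃ b b₁ b₂ → weakDerivL2 0 a =ᵐ[volume.restrict (Ioo ul uu)] b →
      ∃ y, IsMildPressureDrop T C uh ph b y ∧
        IsPressureDrop T c g₀ g₁ a₀ a₁ a₂ a₃ ul uu a y := by
    intro a b b₁ b₂ hj hab
    obtain ⟨y, hy, p, u, hcl, hyp⟩ := exists_mildPressureDrop hT hl ha₀ hj
    exact ⟨y, hy, b, p, u, hj.isAdmissibleDamping ha₀.le, hab, hcl, hyp⟩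
  -- F(a) is a drop for every jet law extending a, whichever law the choice in `forwardOperator`
  -- used. This permits passing to a limit law.
  have hFdrop : ∀ (a : SobolevSpace 2 ul uu) (b b₁ b₂ : ℝ → ℝ),
      IsDampingJet a₀ a₁ a₂ a₃ b b₁ b₂ → weakDerivL2 0 a =ᵐ[volume.restrict (Ioo ul uu)] b →
      IsMildPressureDrop T C uh ph b (F a) := by
    intro a b b₁ b₂ hj hab
    obtain ⟨y, hy, hy'⟩ := hdrop a b b₁ b₂ hj hab
    rwa [hF, forwardOperator_eq hT ha₀ ha₂ ha₃ hu hv hy']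
  have hjet : ∀ a ∈ forwardDomain a₀ a₁ a₂ a₃ ul uu, ∃ b b₁ b₂,
      IsDampingJet a₀ a₁ a₂ a₃ b b₁ b₂ ∧ weakDerivL2 0 a =ᵐ[volume.restrict (Ioo ul uu)] b := by
    rintro a ⟨b, hb, hab⟩
    obtain ⟨b₁, b₂, hj⟩ := hb.exists_jet ha₂.le ha₃.le
    exact ⟨b, b₁, b₂, hj, hab⟩
  have hweak : ∀ (a : ℕ → SobolevSpace 2 ul uu) (a' : SobolevSpace 2 ul uu),
      (∀ n, a n ∈ forwardDomain a₀ a₁ a₂ a₃ ul uu) →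
      Tendsto (fun n => toWeakSpace ℝ (SobolevSpace 2 ul uu) (a n)) atTop
        (𝓝 (toWeakSpace ℝ (SobolevSpace 2 ul uu) a')) →
      a' ∈ forwardDomain a₀ a₁ a₂ a₃ ul uu ∧ Tendsto (fun n => F (a n)) atTop (𝓝 (F a')) := by
    intro a a' ha hw
    choose b b₁ b₂ hj hab using fun n => hjet (a n) (ha n)
    -- The limit law d may depend on U outside the velocity interval, but its restriction is always
    -- a', so the limit F(a') does not depend on U.
    have key : ∀ U : Ultrafilter ℕ, (U : Filter ℕ) ≤ atTop →
        a' ∈ forwardDomain a₀ a₁ a₂ a₃ ul uu ∧ Tendsto (fun n => F (a n)) U (𝓝 (F a')) := by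
      intro U hU
      obtain ⟨d, d₁, d₂, hd, hlim⟩ :=
        IsDampingJet.exists_ultrafilter_limit U ha₀.le (Eventually.of_forall hj)
      have hstrong : Tendsto (fun n => weakDerivL2 0 (a n)) U
          (𝓝 (MemLp.toLp d (hd.continuous.continuousOn.memLp_Ioo (α := ul) (β := uu)))) := by
        refine L2Interval.tendsto_of_uniform fun ε hε => ?_
        filter_upwards [eventually_forall_abs_sub_le_of_lipschitz ha₁.le
          (Eventually.of_forall fun n => (hj n).abs_sub_le ha₀.le) (hd.abs_sub_le ha₀.le) hlim
          (isCompact_Icc (a := ul) (b := uu)) hε] with n hn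
        filter_upwards [hab n, MemLp.coeFn_toLp (hd.continuous.continuousOn.memLp_Ioo (α := ul)
          (β := uu)), ae_restrict_mem measurableSet_Ioo] with v h1 h2 h3
        rw [h1, h2]
        exact hn v (Ioo_subset_Icc_self h3)
      have hwU := hw.mono_left hU
      have ha'd : weakDerivL2 0 a' =ᵐ[volume.restrict (Ioo ul uu)] d := by
        rw [eq_of_tendsto_weak hwU hstrong]
        exact MemLp.coeFn_toLp _
      exact ⟨⟨d, hd.isAdmissibleDamping ha₀.le, ha'd⟩,
        tendsto_pressureDrop hT ha₀.le (Eventually.of_forall hj)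
          (Eventually.of_forall fun n => hFdrop (a n) (b n) (b₁ n) (b₂ n) (hj n) (hab n)) hd
          (hFdrop a' d d₁ d₂ hd ha'd) hlim⟩
    -- A single ultrafilter gives membership; convergence along all ultrafilters below `atTop` gives
    -- convergence of the sequence.
    exact ⟨(key (Ultrafilter.of atTop) (Ultrafilter.of_le _)).1,
      (tendsto_iff_ultrafilter _ _ _).2 fun U hU => (key U hU).2⟩
  refine ⟨fun a ha => ?_, hweak, ?_, fun B hB _ => ?_⟩
  · obtain ⟨b, b₁, b₂, hj, hab⟩ := hjet a ha
    obtain ⟨y, -, hy⟩ := hdrop a b b₁ b₂ hj hab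
    exact ⟨y, hy, fun y' hy' => IsPressureDrop.eq hT ha₀ ha₂ ha₃ hu hv hy' hy⟩
  · rw [continuousOn_iff_continuous_domRestrict]
    -- The domain is metrizable, so sequences suffice, and norm convergence implies weak
    -- convergence.
    refine continuous_iff_seqContinuous.2 fun x z hx => ?_
    exact (hweak (fun n => x n) z (fun n => (x n).2)
      (((toWeakSpaceCLM ℝ (SobolevSpace 2 ul uu)).continuous.tendsto _).comp
        ((continuous_subtype_val.tendsto z).comp hx))).2
  · refine (isCompact_pressureDrops (C := C) (uh := uh) (ph := ph) (a₁ := a₁) (a₂ := a₂) (a₃ := a₃)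
      hT ha₀.le
      fun b b₁ b₂ hj => ?_).closure_of_subset ?_
    · obtain ⟨y, hy, -⟩ := exists_mildPressureDrop hT hl ha₀ hj
      exact ⟨y, hy⟩
    · rintro _ ⟨a, ha, rfl⟩
      obtain ⟨b, b₁, b₂, hj, hab⟩ := hjet a (hB ha)
      exact ⟨b, b₁, b₂, hj, hFdrop a b b₁ b₂ hj hab⟩
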